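/- **Setting.** Let $N\ge 0$, let $x_1,\dots,x_N\in\mathbb R^3$, let $\beta\in\mathbb R^3$ with $\beta\neq 0$, and let $\chi\in\mathcal S(\mathbb R)$ be real valued and such that $\chi(t)=0$ for $0\le t\le\rho$, for some $\rho>0$. Let $(e_1,e_2,e_3)$ be the canonical basis of $\mathbb R^3$, and let $\sigma_1,\sigma_2,\sigma_3$ be the Pauli matrices. *Fock space.* Let $H_{\mathbb C}$ be the Hilbert space of all $f\in L^2(\mathbb R^3;\mathbb C^3)$ such that $k\cdot f(k)=0$ for a.e. $k$. Let $\mathcal F_s(H_{\mathbb C})=\bigoplus_{m\ge0}\mathcal F_m$ (Hilbert sum) be the symmetric Fock space over it, where $\mathcal F_m$ is the space of the maps $f\in L^2((\mathbb R^3)^m;(\mathbb C^3)^{\otimes m})$ that are symmetric under simultaneous permutations of the variables and of the tensor indices, and transverse in each variable ($\sum_j k_{i,j}f_{a_1,\dots,j,\dots,a_m}(k_1,\dots,k_m)=0$ a.e., the index $j$ being at the $i$-th place, for $1\le i\le m$). In particular $\mathcal F_0=\mathbb C$. Let $d\Gamma(M)$ be the operator $(d\Gamma(M)f)_m(k_1,\dots,k_m)=(|k_1|+\dots+|k_m|)f_m(k_1,\dots,k_m)$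 with its natural domain. For $v\in H_{\mathbb C}$, let $\Phi_S(v)=2^{-1/2}(a(v)+a^*(v))$ be the Segal field, where $$(a^*(v)f)_{m;a_1\dots a_m}(k_1,\dots,k_m)=m^{-1/2}\sum_{i=1}^m v_{a_i}(k_i)\,f_{m-1;a_1\dots\widehat{a_i}\dots a_m}(k_1,\dots,\widehat{k_i},\dots,k_m)\quad(m\ge1),\qquad (a^*(v)f)_0=0,$$ $$(a(v)f)_{m;a_1\dots a_m}(k_1,\dots,k_m)=(m+1)^{1/2}\sum_{j=1}^3\int_{\mathbb R^3}\overline{v_j(q)}\,f_{m+1;j a_1\dots a_m}(q,k_1,\dots,k_m)\,dq .$$ *Hamiltonian.* For $h>0$, let $B_m(x)=h^{1/2}\,\Phi_S(a_m(x)+i\,b_m(x))$ with $$a_m(x)(k)=\frac{\chi(|k|)|k|^{1/2}}{(2\pi)^{3/2}}\sin(k\cdot x)\frac{k\wedge e_m}{|k|},\qquad b_m(x)(k)=\frac{\chi(|k|)|k|^{1/2}}{(2\pi)^{3/2}}\cos(k\cdot x)\frac{k\wedge e_m}{|k|}.$$ In $\mathcal F_s(H_{\mathbb C})\otimes\mathcal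 H_{sp}$, where $\mathcal H_{sp}=(\mathbb C^2)^{\otimes N}$, consider $$H(h)=h\,d\Gamma(M)\otimes I+h\sum_{\ell=1}^N\sum_{m=1}^3(\beta_m+B_m(x_\ell))\otimes\sigma_m^{[\ell]},$$ with domain $D(d\Gamma(M))\otimes\mathcal H_{sp}$, where $\sigma_m^{[\ell]}$ is $\sigma_m$ acting on the $\ell$-th factor of $\mathcal H_{sp}$. *Parity spaces.* Let $\mathcal F_{even}(\rho)$ (resp. $\mathcal F_{odd}(\rho)$) be the space of the finite sums of elements $f_m\in\mathcal F_m$ with $m$ even (resp. odd) such that $f_m(k_1,\dots,k_m)=0$ as soon as $|k_i|\le\rho$ for some $i$. Let $b_0\in\mathbb C^2$ be a unit vector such that $\sum_m\beta_m\sigma_m b_0=-|\beta|b_0$, let $a_\emptyset=b_0\otimes\dots\otimes b_0\in\mathcal H_{sp}$, and let $\Psi_0$ be a unit vector of $\mathcal F_0$. **Theorem.** There exist a sequence $(u_j)_{j\ge0}$ in $\mathcal F_s(H_{\mathbb C})\otimes\mathcal H_{sp}$ and a sequence of real numbers $(\lambda_j)_{j\ge1}$, all independent of $h$, such that: 1.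 $u_0=\Psi_0\otimes a_\emptyset$ and $\lambda_1=-N|\beta|$. 2. $u_j\in\mathcal F_{even}(\rho)\otimes\mathcal H_{sp}$ for even $j$, and $u_j\in\mathcal F_{odd}(\rho)\otimes\mathcal H_{sp}$ for odd $j$. 3. For every $n$, the sum $U_n(h)=\sum_{j=0}^{n}h^{j/2}u_j$ belongs to the domain of $H(h)$. 4. For every integer $p\ge0$ there is a constant $C$ such that, for all $h\in(0,1]$, $$\big\|\big(H(h)-(\lambda_1h+\dots+\lambda_{p+1}h^{p+1})\big)U_{2p}(h)\big\|\le C\,h^{p+3/2},\qquad \big\|\big(H(h)-(\lambda_1h+\dots+\lambda_{p+1}h^{p+1})\big)U_{2p+1}(h)\big\|\le C\,h^{p+2}.$$ 5. More precisely, for every integer $p\ge0$ there are finitely many vectors $f_k,g_k\in\mathcal F_s(H_{\mathbb C})\otimes\mathcal H_{sp}$, independent of $h$, such that, for all $h>0$, $$\big(H(h)-(\lambda_1h+\dots+\lambda_{p+1}h^{p+1})\big)U_{2p}(h)=\sum_{k\ge1}h^{p+1+k/2}f_k,\qquad \big(H(h)-(\lambda_1h+\dots+\lambda_{p+1}h^{p+1})\big)U_{2p+1}(h)=\sum_{k\ge0}h^{p+2+k/2}g_k.$$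 -/

import Mathlib

open MeasureTheory Filter Topology
open scoped SchwartzMap Matrix ENNReal

noncomputable section

namespace SpinPhoton

/-- The space `ℝ³` (positions and momenta). -/
abbrev R3 : Type := EuclideanSpace ℝ (Fin 3)

/-- `ℂ³`. -/
abbrev C3 : Type := EuclideanSpace ℂ (Fin 3)

/-- `(ℂ³)^{⊗ m}`: the family of components `f_{a_1 … a_m}`, `a_i ∈ {1, 2, 3}`. -/
abbrev Pol (m : ℕ) : Type := EuclideanSpace ℂ (Fin m → Fin 3)

/-! ### Measure-theoretic facts about `(ℝ³)^m` -/

theorem qmp_perm {m : ℕ} (σ : Equiv.Perm (Fin m)) :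
    Measure.QuasiMeasurePreserving (fun k : Fin m → R3 => k ∘ σ) volume volume := by
  have h := (volume_measurePreserving_piCongrLeft (fun _ : Fin m => R3) σ).symm
  have he : (fun k : Fin m → R3 => k ∘ σ)
      = ⇑(MeasurableEquiv.piCongrLeft (fun _ : Fin m => R3) σ).symm := by
    funext k i
    rfl
  rw [he]
  exact h.quasiMeasurePreserving

theorem qmp_removeNth {n : ℕ} (i : Fin (n + 1)) :
    Measure.QuasiMeasurePreserving (fun k : Fin (n + 1) → R3 => i.removeNth k) volume volume := by
  have h := (volume_preserving_piFinSuccAbove (fun _ : Fin (n + 1) => R3) i).quasiMeasurePreserving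
  exact Measure.quasiMeasurePreserving_snd.comp h

theorem mp_cons (n : ℕ) :
    MeasurePreserving (fun z : R3 × (Fin n → R3) => (Fin.cons z.1 z.2 : Fin (n + 1) → R3))
      (volume.prod volume) volume := by
  have h := (volume_preserving_piFinSuccAbove (fun _ : Fin (n + 1) => R3) 0).symm
  have he : (fun z : R3 × (Fin n → R3) => (Fin.cons z.1 z.2 : Fin (n + 1) → R3))
      = ⇑(MeasurableEquiv.piFinSuccAbove (fun _ : Fin (n + 1) => R3) 0).symm := by
    funext z
    simp [MeasurableEquiv.piFinSuccAbove]
    rfl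
  rw [he]
  exact h

theorem ae_ae_cons {n : ℕ} {P : (Fin (n + 1) → R3) → Prop} (h : ∀ᵐ k, P k) :
    ∀ᵐ k : Fin n → R3, ∀ᵐ q : R3, P (Fin.cons q k) := by
  have h1 := (mp_cons n).quasiMeasurePreserving.ae h
  have h2 := (Measure.measurePreserving_swap
    (μ := (volume : Measure (Fin n → R3))) (ν := (volume : Measure R3))).quasiMeasurePreserving.ae h1
  exact Measure.ae_ae_of_ae_prod h2

/-! ### The one-photon space and the Fock space -/

/-- The complexification `H_ℂ` of the Lieb-Loss space: the square integrable maps `f` from `ℝ³`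
to `ℂ³` such that `k₁ f₁(k) + k₂ f₂(k) + k₃ f₃(k) = 0` for almost every `k`. -/
def onePhotonSpace : Submodule ℂ (Lp C3 2 (volume : Measure R3)) where
  carrier := {f | ∀ᵐ k, ∑ j, (k j : ℂ) * f k j = 0}
  add_mem' {f g} hf hg := by
    filter_upwards [hf, hg, Lp.coeFn_add f g] with k h1 h2 h3
    simp only [h3, Pi.add_apply, PiLp.add_apply, mul_add, Finset.sum_add_distrib, h1, h2, add_zero]
  zero_mem' := ae_of_all _ fun k => by simp
  smul_mem' c f hf := by
    filter_upwards [hf, Lp.coeFn_smul c f] with k h1 h2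
    simp only [h2, Pi.smul_apply, PiLp.smul_apply, smul_eq_mul, mul_left_comm _ c,
      ← Finset.mul_sum, h1, mul_zero]

/-- The `m`-photon space `F_m`: the square integrable maps from `(ℝ³)^m` to `(ℂ³)^{⊗ m}` which are
symmetric under simultaneous permutations of the variables and of the indices, and transverse in
each variable. -/
def photonSector (m : ℕ) : Submodule ℂ (Lp (Pol m) 2 (volume : Measure (Fin m → R3))) where
  carrier := {f | (∀ σ : Equiv.Perm (Fin m), ∀ᵐ k, ∀ a, f (k ∘ σ) (a ∘ σ) = f k a) ∧
    ∀ i : Fin m, ∀ᵐ k, ∀ a, ∑ j : Fin 3, (k i j : ℂ) * f k (Function.update a i j) = 0}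
  add_mem' {f g} hf hg := by
    refine ⟨fun σ => ?_, fun i => ?_⟩
    · filter_upwards [hf.1 σ, hg.1 σ, Lp.coeFn_add f g, (qmp_perm σ).ae (Lp.coeFn_add f g)]
        with k h1 h2 h3 h4 a
      simp only [h3, h4, Pi.add_apply, PiLp.add_apply, h1, h2]
    · filter_upwards [hf.2 i, hg.2 i, Lp.coeFn_add f g] with k h1 h2 h3 a
      simp only [h3, Pi.add_apply, PiLp.add_apply, mul_add, Finset.sum_add_distrib, h1, h2, add_zero]
  zero_mem' := by
    refine ⟨fun σ => ?_, fun i => ?_⟩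
    · exact ae_of_all _ fun k a => by simp
    · exact ae_of_all _ fun k a => by simp
  smul_mem' c f hf := by
    refine ⟨fun σ => ?_, fun i => ?_⟩
    · filter_upwards [hf.1 σ, Lp.coeFn_smul c f, (qmp_perm σ).ae (Lp.coeFn_smul c f)]
        with k h1 h2 h3 a
      simp only [h2, h3, Pi.smul_apply, PiLp.smul_apply, h1]
    · filter_upwards [hf.2 i, Lp.coeFn_smul c f] with k h1 h2 a
      simp only [h2, Pi.smul_apply, PiLp.smul_apply, smul_eq_mul, mul_left_comm _ c,
        ← Finset.mul_sum, h1, mul_zero]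

/-- The symmetric Fock space over `H_ℂ`: the Hilbert sum of the `F_m`, `m ≥ 0`. -/
abbrev PhotonFock : Type := lp (fun m : ℕ => photonSector m) 2

/-- The component `f_{a_1 … a_m}(k_1, …, k_m)` of the `m`-photon part of `f`. -/
def component (f : PhotonFock) (m : ℕ) (k : Fin m → R3) (a : Fin m → Fin 3) : ℂ :=
  ((f m : photonSector m) : Lp (Pol m) 2 (volume : Measure (Fin m → R3))) k a

theorem component_add (f g : PhotonFock) (m : ℕ) :
    ∀ᵐ k, ∀ a, component (f + g) m k a = component f m k a + component g m k a := by
  filter_upwards [Lp.coeFn_add ((f m : photonSector m) : Lp (Pol m) 2 volume)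
    ((g m : photonSector m) : Lp (Pol m) 2 volume)] with k hk a
  exact congrArg (fun w : Pol m => w a) hk

theorem component_smul (c : ℂ) (f : PhotonFock) (m : ℕ) :
    ∀ᵐ k, ∀ a, component (c • f) m k a = c * component f m k a := by
  filter_upwards [Lp.coeFn_smul c ((f m : photonSector m) : Lp (Pol m) 2 volume)] with k hk a
  exact congrArg (fun w : Pol m => w a) hk

theorem component_zero (m : ℕ) : ∀ᵐ k, ∀ a, component 0 m k a = 0 := by
  filter_upwards [Lp.coeFn_zero (Pol m) 2 (volume : Measure (Fin m → R3))] with k hk a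
  exact congrArg (fun w : Pol m => w a) hk

theorem eq_zero_of_component {f : PhotonFock} (h : ∀ m, ∀ᵐ k, ∀ a, component f m k a = 0) :
    f = 0 := by
  ext1
  funext m
  apply Subtype.ext
  apply Lp.ext
  filter_upwards [h m, Lp.coeFn_zero (Pol m) 2 (volume : Measure (Fin m → R3))] with k hk h0
  ext a
  simpa [component, h0] using hk a

theorem memLp_component (f : PhotonFock) (m : ℕ) (a : Fin m → Fin 3) :
    MemLp (fun k => component f m k a) 2 volume := by
  have h := Lp.memLp ((f m : photonSector m) : Lp (Pol m) 2 (volume : Measure (Fin m → R3)))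
  refine h.of_le ?_ ?_
  · exact (EuclideanSpace.proj (𝕜 := ℂ) a).continuous.comp_aestronglyMeasurable h.1
  · exact ae_of_all _ fun k => PiLp.norm_apply_le _ a

/-! ### Second quantization of the multiplication by `|k|` -/

/-- The graph of `dΓ(M)`: `(dΓ(M) f)_m (k_1, …, k_m) = (|k_1| + ⋯ + |k_m|) f_m (k_1, …, k_m)`. -/
def dGammaGraph : Submodule ℂ (PhotonFock × PhotonFock) where
  carrier := {p | ∀ m, ∀ᵐ k : Fin m → R3, ∀ a,
    component p.2 m k a = ((∑ i, ‖k i‖ : ℝ) : ℂ) * component p.1 m k a}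
  add_mem' {p q} hp hq m := by
    filter_upwards [hp m, hq m, component_add p.1 q.1 m, component_add p.2 q.2 m]
      with k h1 h2 h3 h4 a
    simp only [Prod.fst_add, Prod.snd_add, h1, h2, h3, h4, mul_add]
  zero_mem' m := by
    filter_upwards [component_zero m] with k h1 a
    simp only [Prod.fst_zero, Prod.snd_zero, h1, mul_zero]
  smul_mem' c p hp m := by
    filter_upwards [hp m, component_smul c p.1 m, component_smul c p.2 m] with k h1 h2 h3 a
    simp only [Prod.smul_fst, Prod.smul_snd, h1, h2, h3, mul_left_comm]

/-- `dΓ(M)`, where `M` is the multiplication by `|k|`, as an unbounded operator in the Fock space,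
with its natural (maximal) domain. -/
def dGamma : PhotonFock →ₗ.[ℂ] PhotonFock := dGammaGraph.toLinearPMap

/-- `dGamma` does have the graph by which it is defined. -/
theorem dGamma_graph : dGamma.graph = dGammaGraph := by
  refine Submodule.toLinearPMap_graph_eq _ fun p hp h0 => eq_zero_of_component fun m => ?_
  filter_upwards [hp m, component_zero m] with k h1 h2 a
  rw [h1, h0, h2, mul_zero]

/-! ### Segal fields -/

/-- `(a*(v) f)_m`: the creation operator,
`m^{-1/2} ∑ᵢ v_{aᵢ}(kᵢ) f_{m-1}(…, k̂ᵢ, …)` (zero for `m = 0`). -/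
def creation (v : onePhotonSpace) (f : PhotonFock) :
    (m : ℕ) → (Fin m → R3) → (Fin m → Fin 3) → ℂ
  | 0, _, _ => 0
  | n + 1, k, a => ((√((n : ℝ) + 1))⁻¹ : ℝ) * ∑ i : Fin (n + 1),
      (v : Lp C3 2 (volume : Measure R3)) (k i) (a i)
        * component f n (i.removeNth k) (i.removeNth a)

/-- `(a(v) f)_m`: the annihilation operator,
`(m+1)^{1/2} ∑ⱼ ∫ conj(v_j(q)) f_{m+1}(q, k_1, …, k_m) dq`. -/
def annihilation (v : onePhotonSpace) (f : PhotonFock)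
    (m : ℕ) (k : Fin m → R3) (a : Fin m → Fin 3) : ℂ :=
  (√((m : ℝ) + 1) : ℝ) * ∑ j : Fin 3, ∫ q : R3,
    starRingEnd ℂ ((v : Lp C3 2 (volume : Measure R3)) q j)
      * component f (m + 1) (Fin.cons q k) (Fin.cons j a)

theorem creation_add (v : onePhotonSpace) (f g : PhotonFock) (m : ℕ) :
    ∀ᵐ k, ∀ a, creation v (f + g) m k a = creation v f m k a + creation v g m k a := by
  cases m with
  | zero => exact ae_of_all _ fun k a => by simp [creation]
  | succ n =>
    have h : ∀ i : Fin (n + 1), ∀ᵐ k : Fin (n + 1) → R3, ∀ a,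
        component (f + g) n (i.removeNth k) a
          = component f n (i.removeNth k) a + component g n (i.removeNth k) a :=
      fun i => (qmp_removeNth i).ae (component_add f g n)
    filter_upwards [ae_all_iff.2 h] with k hk a
    simp only [creation, hk, mul_add, Finset.sum_add_distrib]

theorem creation_smul (v : onePhotonSpace) (c : ℂ) (f : PhotonFock) (m : ℕ) :
    ∀ᵐ k, ∀ a, creation v (c • f) m k a = c * creation v f m k a := by
  cases m with
  | zero => exact ae_of_all _ fun k a => by simp [creation]
  | succ n =>
    have h : ∀ i : Fin (n + 1), ∀ᵐ k : Fin (n + 1) → R3, ∀ a,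
        component (c • f) n (i.removeNth k) a = c * component f n (i.removeNth k) a :=
      fun i => (qmp_removeNth i).ae (component_smul c f n)
    filter_upwards [ae_all_iff.2 h] with k hk a
    simp only [creation, hk, mul_left_comm _ c, ← Finset.mul_sum]

/-- The integrals in the annihilation operator converge. -/
theorem integrable_annihilation (v : onePhotonSpace) (f : PhotonFock) (m : ℕ) :
    ∀ᵐ k : Fin m → R3, ∀ (a : Fin m → Fin 3) (j : Fin 3), Integrable fun q : R3 =>
      starRingEnd ℂ ((v : Lp C3 2 (volume : Measure R3)) q j)
        * component f (m + 1) (Fin.cons q k) (Fin.cons j a) := by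
  have hv : ∀ j : Fin 3, MemLp (fun q : R3 =>
      starRingEnd ℂ ((v : Lp C3 2 (volume : Measure R3)) q j)) 2 volume := fun j => by
    have h := Lp.memLp (v : Lp C3 2 (volume : Measure R3))
    refine h.of_le ?_ (ae_of_all _ fun k => ?_)
    · exact (Complex.continuous_conj.comp
        (EuclideanSpace.proj (𝕜 := ℂ) j).continuous).comp_aestronglyMeasurable h.1
    · simpa using PiLp.norm_apply_le ((v : Lp C3 2 (volume : Measure R3)) k) j
  have hf : ∀ b : Fin (m + 1) → Fin 3, ∀ᵐ k : Fin m → R3,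
      MemLp (fun q : R3 => component f (m + 1) (Fin.cons q k) b) 2 volume := fun b => by
    have h1 : MemLp (fun z : R3 × (Fin m → R3) => component f (m + 1) (Fin.cons z.1 z.2) b) 2
        (volume.prod volume) := (memLp_component f (m + 1) b).comp_measurePreserving (mp_cons m)
    have h2 := (memLp_two_iff_integrable_sq_norm h1.1).1 h1
    filter_upwards [h2.prod_left_ae, h1.1.prodMk_right] with k h3 h4
    exact (memLp_two_iff_integrable_sq_norm h4).2 h3
  filter_upwards [ae_all_iff.2 hf] with k hk a j
  exact (hv j).integrable_mul (hk _)

theorem annihilation_add (v : onePhotonSpace) (f g : PhotonFock) (m : ℕ) :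
    ∀ᵐ k, ∀ a,
      annihilation v (f + g) m k a = annihilation v f m k a + annihilation v g m k a := by
  have hc := ae_ae_cons (component_add f g (m + 1))
  filter_upwards [integrable_annihilation v f m, integrable_annihilation v g m, hc] with k hf hg hk a
  simp only [annihilation]
  rw [← mul_add, ← Finset.sum_add_distrib]
  congr 1
  refine Finset.sum_congr rfl fun j _ => ?_
  rw [← integral_add (hf a j) (hg a j)]
  refine integral_congr_ae ?_
  filter_upwards [hk] with q hq
  rw [hq, mul_add]

theorem annihilation_smul (v : onePhotonSpace) (c : ℂ) (f : PhotonFock) (m : ℕ) :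
    ∀ᵐ k, ∀ a, annihilation v (c • f) m k a = c * annihilation v f m k a := by
  have hc := ae_ae_cons (component_smul c f (m + 1))
  filter_upwards [hc] with k hk a
  simp only [annihilation]
  rw [mul_left_comm]
  congr 1
  rw [Finset.mul_sum]
  refine Finset.sum_congr rfl fun j _ => ?_
  rw [← integral_const_mul]
  refine integral_congr_ae ?_
  filter_upwards [hk] with q hq
  rw [hq, mul_left_comm]

/-- The graph of the Segal field `Φ_S(v) = 2^{-1/2} (a(v) + a*(v))`. -/
def segalGraph (v : onePhotonSpace) : Submodule ℂ (PhotonFock × PhotonFock) where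
  carrier := {p | ∀ m, ∀ᵐ k : Fin m → R3, ∀ a,
    component p.2 m k a = ((√2)⁻¹ : ℝ) * (annihilation v p.1 m k a + creation v p.1 m k a)}
  add_mem' {p q} hp hq m := by
    filter_upwards [hp m, hq m, component_add p.2 q.2 m, annihilation_add v p.1 q.1 m,
      creation_add v p.1 q.1 m] with k h1 h2 h3 h4 h5 a
    simp only [Prod.fst_add, Prod.snd_add, h1, h2, h3, h4, h5]
    ring
  zero_mem' m := by
    filter_upwards [component_zero m, annihilation_smul v 0 0 m, creation_smul v 0 0 m]
      with k h1 h2 h3 a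
    have h2' := h2 a
    have h3' := h3 a
    rw [smul_zero, zero_mul] at h2' h3'
    simp only [Prod.fst_zero, Prod.snd_zero, h1, h2', h3', add_zero, mul_zero]
  smul_mem' c p hp m := by
    filter_upwards [hp m, component_smul c p.2 m, annihilation_smul v c p.1 m,
      creation_smul v c p.1 m] with k h1 h2 h3 h4 a
    simp only [Prod.smul_fst, Prod.smul_snd, h1, h2, h3, h4]
    ring

/-- The Segal field `Φ_S(v)`, as an unbounded operator in the Fock space, with its natural
(maximal) domain. -/
def segalField (v : onePhotonSpace) : PhotonFock →ₗ.[ℂ] PhotonFock :=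
  (segalGraph v).toLinearPMap

/-- `segalField v` does have the graph by which it is defined. -/
theorem segalField_graph (v : onePhotonSpace) : (segalField v).graph = segalGraph v := by
  refine Submodule.toLinearPMap_graph_eq _ fun p hp h0 => eq_zero_of_component fun m => ?_
  filter_upwards [hp m, annihilation_smul v 0 0 m, creation_smul v 0 0 m] with k h1 h2 h3 a
  have h2' := h2 a
  have h3' := h3 a
  rw [smul_zero, zero_mul] at h2' h3'
  rw [h1, h0, h2', h3', add_zero, mul_zero]

/-! ### The quantized magnetic field -/

/-- The factor `χ(|k|) |k|^{1/2} / (2π)^{3/2}`. -/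
def formFactor (χ : 𝓢(ℝ, ℝ)) (k : R3) : ℝ := χ ‖k‖ * √‖k‖ / (2 * Real.pi) ^ (3 / 2 : ℝ)

/-- The `j`-th component of `(k ∧ e_m) / |k|`. -/
def polarization (m : Fin 3) (k : R3) (j : Fin 3) : ℝ :=
  crossProduct k.ofLp (Pi.single m 1) j / ‖k‖

/-- `a_m(x)(k) = χ(|k|) |k|^{1/2} (2π)^{-3/2} sin(k · x) (k ∧ e_m) / |k|`. -/
def aField (χ : 𝓢(ℝ, ℝ)) (m : Fin 3) (x k : R3) (j : Fin 3) : ℝ :=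
  formFactor χ k * Real.sin (inner ℝ k x) * polarization m k j

/-- `b_m(x)(k) = χ(|k|) |k|^{1/2} (2π)^{-3/2} cos(k · x) (k ∧ e_m) / |k|`. -/
def bField (χ : 𝓢(ℝ, ℝ)) (m : Fin 3) (x k : R3) (j : Fin 3) : ℝ :=
  formFactor χ k * Real.cos (inner ℝ k x) * polarization m k j

/-- The map `a_m(x) + i b_m(x)` from `ℝ³` to `ℂ³`. -/
def fieldFun (χ : 𝓢(ℝ, ℝ)) (m : Fin 3) (x k : R3) : C3 :=
  WithLp.toLp 2 fun j => (aField χ m x k j : ℂ) + Complex.I * (bField χ m x k j : ℂ)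

theorem abs_polarization_le (m : Fin 3) (k : R3) (j : Fin 3) : |polarization m k j| ≤ 2 := by
  have hk : ∀ i, |k i| ≤ ‖k‖ := fun i => by simpa using PiLp.norm_apply_le k i
  have h0 := norm_nonneg k
  rw [polarization, abs_div, abs_norm]
  refine div_le_of_le_mul₀ h0 (by norm_num) ?_
  have h1 := hk 0
  have h2 := hk 1
  have h3 := hk 2
  fin_cases m <;> fin_cases j <;> simp [cross_apply] <;> linarith

theorem measurable_formFactor (χ : 𝓢(ℝ, ℝ)) : Measurable (formFactor χ) := by
  unfold formFactor
  have := χ.continuous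
  have h : Continuous fun k : R3 => χ ‖k‖ * √‖k‖ := by fun_prop
  exact h.measurable.div_const _

theorem measurable_polarization (m : Fin 3) (j : Fin 3) :
    Measurable fun k : R3 => polarization m k j := by
  unfold polarization
  refine Measurable.div ?_ measurable_norm
  have h : Continuous fun k : R3 => crossProduct k.ofLp (Pi.single m (1 : ℝ)) j := by
    fin_cases j <;> simp only [cross_apply] <;> simp <;> fun_prop
  exact h.measurable

theorem memLp_formFactor (χ : 𝓢(ℝ, ℝ)) : MemLp (formFactor χ) 2 (volume : Measure R3) := by
  obtain ⟨C, hC⟩ : ∃ C, ∀ t : ℝ, (1 + ‖t‖) ^ 3 * ‖χ t‖ ≤ C := ⟨_, fun t => by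
    simpa using SchwartzMap.one_add_le_sup_seminorm_apply (𝕜 := ℝ) (m := (3, 0)) le_rfl le_rfl χ t⟩
  have hC0 : 0 ≤ C := le_trans (by positivity) (hC 0)
  rw [memLp_two_iff_integrable_sq (measurable_formFactor χ).aestronglyMeasurable]
  have hint : Integrable (fun k : R3 => (1 + ‖k‖) ^ (-(5 : ℝ))) volume :=
    integrable_one_add_norm (by simp; norm_num)
  set D : ℝ := ((2 * Real.pi) ^ (3 / 2 : ℝ))⁻¹ with hD
  refine (hint.const_mul (C ^ 2 * D ^ 2)).mono'
    ((measurable_formFactor χ).pow_const 2).aestronglyMeasurable (ae_of_all _ fun k => ?_)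
  have hr : 0 ≤ ‖k‖ := norm_nonneg k
  have h1 := hC ‖k‖
  rw [norm_norm] at h1
  have hp : (0 : ℝ) < 1 + ‖k‖ := by positivity
  have h2 : (1 + ‖k‖) ^ 6 * (χ ‖k‖) ^ 2 ≤ C ^ 2 := by
    have := pow_le_pow_left₀ (by positivity) h1 2
    rw [mul_pow, Real.norm_eq_abs, sq_abs] at this
    simpa [← pow_mul] using this
  rw [Real.norm_eq_abs, abs_of_nonneg (sq_nonneg _), formFactor, div_eq_mul_inv, ← hD, mul_pow,
    mul_pow, Real.sq_sqrt hr]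
  have h3 : (1 + ‖k‖) ^ (-(5 : ℝ)) = ((1 + ‖k‖) ^ 5)⁻¹ := by
    rw [Real.rpow_neg hp.le]
    norm_cast
  rw [h3, ← div_eq_mul_inv, le_div_iff₀ (by positivity)]
  have h4 : ‖k‖ * (1 + ‖k‖) ^ 5 ≤ (1 + ‖k‖) ^ 6 := by
    have : (0 : ℝ) ≤ (1 + ‖k‖) ^ 5 := by positivity
    nlinarith
  have h5 : χ ‖k‖ ^ 2 * (‖k‖ * (1 + ‖k‖) ^ 5) ≤ C ^ 2 := by
    refine le_trans (mul_le_mul_of_nonneg_left h4 (sq_nonneg _)) ?_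
    linarith
  nlinarith [mul_le_mul_of_nonneg_right h5 (sq_nonneg D)]

theorem memLp_aField (χ : 𝓢(ℝ, ℝ)) (m : Fin 3) (x : R3) (j : Fin 3) :
    MemLp (fun k => aField χ m x k j) 2 (volume : Measure R3) := by
  refine ((memLp_formFactor χ).const_mul 2).of_le ?_ (ae_of_all _ fun k => ?_)
  · have h : Measurable fun k : R3 => Real.sin (inner ℝ k x) := by fun_prop
    exact (((measurable_formFactor χ).mul h).mul (measurable_polarization m j)).aestronglyMeasurable
  · simp only [aField, norm_mul, Real.norm_eq_abs, Nat.abs_ofNat]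
    have h1 := abs_polarization_le m k j
    have h2 := Real.abs_sin_le_one (inner ℝ k x)
    have h3 : |Real.sin (inner ℝ k x)| * |polarization m k j| ≤ 1 * 2 := by gcongr
    have := mul_le_mul_of_nonneg_left h3 (abs_nonneg (formFactor χ k))
    linarith

theorem memLp_bField (χ : 𝓢(ℝ, ℝ)) (m : Fin 3) (x : R3) (j : Fin 3) :
    MemLp (fun k => bField χ m x k j) 2 (volume : Measure R3) := by
  refine ((memLp_formFactor χ).const_mul 2).of_le ?_ (ae_of_all _ fun k => ?_)
  · have h : Measurable fun k : R3 => Real.cos (inner ℝ k x) := by fun_prop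
    exact (((measurable_formFactor χ).mul h).mul (measurable_polarization m j)).aestronglyMeasurable
  · simp only [bField, norm_mul, Real.norm_eq_abs, Nat.abs_ofNat]
    have h1 := abs_polarization_le m k j
    have h2 := Real.abs_cos_le_one (inner ℝ k x)
    have h3 : |Real.cos (inner ℝ k x)| * |polarization m k j| ≤ 1 * 2 := by gcongr
    have := mul_le_mul_of_nonneg_left h3 (abs_nonneg (formFactor χ k))
    linarith

theorem memLp_fieldFun (χ : 𝓢(ℝ, ℝ)) (m : Fin 3) (x : R3) :
    MemLp (fieldFun χ m x) 2 (volume : Measure R3) := by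
  refine MemLp.of_eval_piLp fun j => ?_
  have h1 : MemLp (fun k => (aField χ m x k j : ℂ)) 2 (volume : Measure R3) :=
    (memLp_aField χ m x j).ofReal
  have h2 : MemLp (fun k => (bField χ m x k j : ℂ)) 2 (volume : Measure R3) :=
    (memLp_bField χ m x j).ofReal
  have h3 := h1.add (h2.const_mul Complex.I)
  exact h3

theorem fieldFun_transverse (χ : 𝓢(ℝ, ℝ)) (m : Fin 3) (x k : R3) :
    ∑ j, (k j : ℂ) * fieldFun χ m x k j = 0 := by
  have h : ∑ j, k j * polarization m k j = 0 := by
    simp only [polarization, mul_div_assoc', ← Finset.sum_div]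
    have := dot_self_cross k.ofLp (Pi.single m (1 : ℝ))
    rw [dotProduct] at this
    rw [this, zero_div]
  have h' : ∑ j, (k j : ℂ) * (polarization m k j : ℂ) = 0 := by exact_mod_cast h
  have he : ∀ j, (k j : ℂ) * fieldFun χ m x k j
      = ((formFactor χ k * Real.sin (inner ℝ k x) : ℝ)
        + Complex.I * (formFactor χ k * Real.cos (inner ℝ k x) : ℝ))
        * ((k j : ℂ) * (polarization m k j : ℂ)) := fun j => by
    simp only [fieldFun, aField, bField]
    push_cast
    ring
  rw [Finset.sum_congr rfl fun j _ => he j, ← Finset.mul_sum, h', mul_zero]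

theorem fieldFun_mem (χ : 𝓢(ℝ, ℝ)) (m : Fin 3) (x : R3) :
    (memLp_fieldFun χ m x).toLp (fieldFun χ m x) ∈ onePhotonSpace := by
  have h : ∀ᵐ k : R3, ∑ j, (k j : ℂ) * (memLp_fieldFun χ m x).toLp (fieldFun χ m x) k j = 0 := by
    filter_upwards [(memLp_fieldFun χ m x).coeFn_toLp] with k hk
    rw [← fieldFun_transverse χ m x k]
    exact Finset.sum_congr rfl fun j _ => congrArg (fun w : C3 => (k j : ℂ) * w j) hk
  exact h

/-- `a_m(x) + i b_m(x)` as an element of `H_ℂ`. -/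
def fieldVector (χ : 𝓢(ℝ, ℝ)) (m : Fin 3) (x : R3) : onePhotonSpace :=
  ⟨(memLp_fieldFun χ m x).toLp (fieldFun χ m x), fieldFun_mem χ m x⟩

/-- The operator `B_m(x)` in the Fock space, `h` being the semiclassical parameter:
`B_m(x) = h^{1/2} Φ_S(a_m(x) + i b_m(x))`. -/
def magneticField (χ : 𝓢(ℝ, ℝ)) (h : ℝ) (m : Fin 3) (x : R3) : PhotonFock →ₗ.[ℂ] PhotonFock :=
  ((√h : ℝ) : ℂ) • segalField (fieldVector χ m x)

/-! ### Spins -/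

/-- Indices of the canonical basis of `(ℂ²)^{⊗ N}`. -/
abbrev Config (N : ℕ) : Type := Fin N → Fin 2

/-- The spin space `(ℂ²)^{⊗ N}`. -/
abbrev SpinSpace (N : ℕ) : Type := EuclideanSpace ℂ (Config N)

/-- The Pauli matrices. -/
def pauli : Fin 3 → Matrix (Fin 2) (Fin 2) ℂ :=
  ![!![0, 1; 1, 0], !![0, -Complex.I; Complex.I, 0], !![1, 0; 0, -1]]

/-- `σ_j^{[l]} = I ⊗ ⋯ ⊗ σ_j ⊗ ⋯ ⊗ I`, with `σ_j` at the `l`-th position. -/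
def spinMatrix {N : ℕ} (j : Fin 3) (l : Fin N) : Matrix (Config N) (Config N) ℂ :=
  Matrix.of fun s t => ∏ i : Fin N, (if i = l then pauli j else 1) (s i) (t i)

/-- The elementary tensor `c_1 ⊗ ⋯ ⊗ c_N` in `(ℂ²)^{⊗ N}`. -/
def spinTensor {N : ℕ} (c : Fin N → EuclideanSpace ℂ (Fin 2)) : SpinSpace N :=
  WithLp.toLp 2 fun s => ∏ i, c i (s i)

/-! ### The Hamiltonian -/

/-- The Hilbert space `F_s(H_ℂ) ⊗ (ℂ²)^{⊗ N}`: the families of elements of the Fock space indexed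
by the canonical basis of `(ℂ²)^{⊗ N}`, the squared norm being the sum of the squared norms. -/
abbrev StateSpace (N : ℕ) : Type := PiLp 2 fun _ : Config N => PhotonFock

/-- The elementary tensor `Ψ ⊗ c`. -/
def pureTensor {N : ℕ} (Ψ : PhotonFock) (c : SpinSpace N) : StateSpace N :=
  WithLp.toLp 2 fun s => c s • Ψ

/-- The operator `A ⊗ S`, with domain `D(A) ⊗ (ℂ²)^{⊗ N}`. -/
def tensorOp {N : ℕ} (A : PhotonFock →ₗ.[ℂ] PhotonFock) (S : Matrix (Config N) (Config N) ℂ) :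
    StateSpace N →ₗ.[ℂ] StateSpace N where
  domain :=
    { carrier := {f | ∀ s, f s ∈ A.domain}
      add_mem' := fun hf hg s => A.domain.add_mem (hf s) (hg s)
      zero_mem' := fun _ => A.domain.zero_mem
      smul_mem' := fun c _ hf s => A.domain.smul_mem c (hf s) }
  toFun :=
    { toFun := fun f => WithLp.toLp 2 fun s => ∑ t, S s t • A ⟨f.1 t, f.2 t⟩
      map_add' := fun f g => by
        ext1 s
        simp only [PiLp.add_apply, ← Finset.sum_add_distrib, ← smul_add, ← A.map_add]
        rfl
      map_smul' := fun c f => by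
        ext1 s
        show _ = c • ∑ t, S s t • A ⟨f.1 t, f.2 t⟩
        refine Eq.trans (Finset.sum_congr rfl fun t _ => ?_) Finset.smul_sum.symm
        exact (congrArg (fun w => S s t • w) (A.map_smul c ⟨f.1 t, f.2 t⟩)).trans
          (smul_comm _ _ _) }

/-- The multiplication by the scalar `c`, defined everywhere. -/
def scalarOp (c : ℂ) : PhotonFock →ₗ.[ℂ] PhotonFock := (c • LinearMap.id).toPMap ⊤

/-- The Hamiltonian
`H(h) = h dΓ(M) ⊗ I + h ∑_l ∑_j (β_j + B_j(x_l)) ⊗ σ_j^{[l]}`. The domain of a sum of unbounded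
operators is the intersection of their domains, which is `D(dΓ(M)) ⊗ (ℂ²)^{⊗ N}` here when `χ`
vanishes near `0`: the Segal fields are then bounded relatively to `dΓ(M)^{1/2}`. -/
def hamiltonian {N : ℕ} (χ : 𝓢(ℝ, ℝ)) (β : R3) (x : Fin N → R3) (h : ℝ) :
    StateSpace N →ₗ.[ℂ] StateSpace N :=
  tensorOp ((h : ℂ) • dGamma) 1
    + (h : ℂ) • ∑ l : Fin N, ∑ j : Fin 3,
        tensorOp (scalarOp (β j : ℂ) + magneticField χ h j (x l)) (spinMatrix j l)

/-! ### Parity, and the truncated expansions -/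

/-- `ψ` belongs to `F_even(ρ) ⊗ (ℂ²)^{⊗ N}` if `j` is even, and to `F_odd(ρ) ⊗ (ℂ²)^{⊗ N}` if `j`
is odd: it has finitely many photons, the number of photons has the parity of `j`, and every
`ψ_m(k_1, …, k_m)` vanishes if `|k_i| ≤ ρ` for some `i`. -/
def HasParity {N : ℕ} (ρ : ℝ) (j : ℕ) (ψ : StateSpace N) : Prop :=
  ∀ s : Config N, (∃ n : ℕ, ∀ m, n < m → (ψ s : PhotonFock) m = 0) ∧
    (∀ m, m % 2 ≠ j % 2 → (ψ s : PhotonFock) m = 0) ∧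
    ∀ m, ∀ᵐ k : Fin m → R3, (∃ i, ‖k i‖ ≤ ρ) → ∀ a, component (ψ s) m k a = 0

/-- The truncated sum `∑_{j = 0}^{n} h^{j/2} u_j`. -/
def truncation {N : ℕ} (u : ℕ → StateSpace N) (n : ℕ) (h : ℝ) : StateSpace N :=
  ∑ j ∈ Finset.range (n + 1), ((h ^ ((j : ℝ) / 2) : ℝ) : ℂ) • u j

/-- The truncated sum `λ_1 h + ⋯ + λ_{p+1} h^{p+1}`. -/
def approxEigenvalue (lam : ℕ → ℝ) (p : ℕ) (h : ℝ) : ℝ :=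
  ∑ j ∈ Finset.Icc 1 (p + 1), lam j * h ^ j

end SpinPhoton

end

open SpinPhoton

open MeasureTheory Filter Topology
open scoped SchwartzMap Matrix ENNReal
open SpinPhoton

noncomputable section

/-! ### Formal perturbation theory for a simple eigenvalue -/

section FormalPerturbation

variable {E : Type*} [NormedAddCommGroup E] [InnerProductSpace ℂ E]

/-! Put `t = √h`. The Hamiltonian factors as `H(h) = h (A + t V)`, where `A` is `dΓ(M)` plus the
Zeeman term and `V` is the sum of the Segal fields tensored with spin matrices, both independent of
`h` (`hamiltonian_mem_graph`). The theorem is then Rayleigh-Schrödinger perturbation theory in `t`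
around the eigenvector `u₀` of `A` with eigenvalue `e₀ = -N|β|`: the formal equation `(A + t V) ∑ tⁿ
uₙ = (∑ tⁿ eₙ)(∑ tⁿ uₙ)` is solved order by order (`exists_formal_eigenvector`).

Each order requires inverting `A - e₀` off `u₀`. The eigenvalue `0` of `dΓ(M)` is not isolated in
its spectrum, and the infrared cutoff replaces the missing gap. Since `χ` vanishes on `[0, ρ]`, `V`
preserves the finite particle vectors all of whose photons have momentum above `ρ`
(`exists_segalField`), and on these `dΓ(M) ≥ ρ` outside the vacuum sector. Expanding the spins in a
product eigenbasis of the Zeeman term reduces `A - e₀` to operators `dΓ(M) + c` with `c ≥ 0`, where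
`c = 0` only when every spin is in the state `b₀` (`exists_resolvent_dGamma`,
`exists_resolvent_free`).

`V` changes the photon number by one, so `uₙ` has the parity of `n`. For odd `n`, `eₙ` is up to sign
the inner product of `u₀` with a vector of odd photon number, hence zero: the eigenvalue expands in
integer powers of `h`. The `eₙ` are real because `A` and `V` are symmetric (`inner_dGamma`,
`inner_segalField`, `conj_eq_of_formal_eigen`).

Truncating at order `n` leaves only the powers `t ^ (n + 1)` and higher (`isPolyTail_residual`). The
prefactor `h = t²` raises this to `t ^ (n + 3)`, and `e_{2p+1} = 0` lets one approximate eigenvalue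
serve both `U_{2p}` and `U_{2p+1}`. -/

/-- The Rayleigh-Schrödinger recursion: the terms of a formal eigenvector and of the corresponding
formal eigenvalue, `v` being the perturbation and `R` a reduced resolvent. -/
def rayleighSeq (v R : ℕ → E → E) (u₀ : E) (e₀ : ℂ) : ℕ → E × ℂ
  | 0 => (u₀, e₀)
  | n + 1 =>
    let w := -(v n (rayleighSeq v R u₀ e₀ n).1) + ∑ i : Fin n,
      (rayleighSeq v R u₀ e₀ (i + 1)).2 • (rayleighSeq v R u₀ e₀ (n - i)).1
    (R (n + 1) w, -inner ℂ u₀ w)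
termination_by n => n
decreasing_by all_goals omega

/-- The generating series of the inner products of two sequences of vectors. -/
def innerSeries (x y : ℕ → E) : PowerSeries ℂ :=
  PowerSeries.mk fun n => ∑ p ∈ Finset.HasAntidiagonal.antidiagonal n, inner ℂ (x p.1) (y p.2)

theorem map_conj_innerSeries (x y : ℕ → E) :
    (innerSeries x y).map (starRingEnd ℂ) = innerSeries y x := by
  ext n
  simp only [innerSeries, PowerSeries.coeff_map, PowerSeries.coeff_mk, map_sum, inner_conj_symm]
  rw [← Finset.Nat.sum_antidiagonal_swap]; rfl

/-- Linearity in the second argument, at the level of Cauchy products: a scalar formal series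
factors out of the formal inner product. -/
theorem innerSeries_conv (x y : ℕ → E) (e : ℕ → ℂ) :
    innerSeries x (fun n => ∑ p ∈ Finset.HasAntidiagonal.antidiagonal n, e p.1 • y p.2)
      = PowerSeries.mk e * innerSeries x y := by
  ext n
  simp only [innerSeries, PowerSeries.coeff_mk, PowerSeries.coeff_mul, inner_sum, inner_smul_right,
    Finset.mul_sum]
  rw [Finset.sum_sigma', Finset.sum_sigma']
  -- Both sides run over triples of sum `n`, bracketed differently. Exchanging the index of `e` with
  -- that of `x` is an involution, so the same map serves as its own inverse.
  refine Finset.sum_nbij' (fun z => ⟨(z.2.1, z.1.1 + z.2.2), (z.1.1, z.2.2)⟩)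
    (fun z => ⟨(z.2.1, z.1.1 + z.2.2), (z.1.1, z.2.2)⟩) ?_ ?_ ?_ ?_ ?_
  · rintro ⟨⟨i, k⟩, ⟨p, q⟩⟩ h
    simp only [Finset.mem_sigma, Finset.HasAntidiagonal.mem_antidiagonal] at h ⊢
    exact ⟨by linarith [h.1, h.2], trivial⟩
  · rintro ⟨⟨i, k⟩, ⟨p, q⟩⟩ h
    simp only [Finset.mem_sigma, Finset.HasAntidiagonal.mem_antidiagonal] at h ⊢
    exact ⟨by linarith [h.1, h.2], trivial⟩
  · rintro ⟨⟨i, k⟩, ⟨p, q⟩⟩ h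
    simp only [Finset.mem_sigma, Finset.HasAntidiagonal.mem_antidiagonal] at h ⊢
    simp [h.2]
  · rintro ⟨⟨i, k⟩, ⟨p, q⟩⟩ h
    simp only [Finset.mem_sigma, Finset.HasAntidiagonal.mem_antidiagonal] at h ⊢
    simp [h.2]
  · rintro ⟨⟨i, k⟩, ⟨p, q⟩⟩ h
    rfl

/-- A formal eigenvalue of a symmetric formal operator is real. -/
theorem conj_eq_of_formal_eigen {u a b : ℕ → E} {e : ℕ → ℂ} (hu : ‖u 0‖ = 1)
    (hA : ∀ i j, inner ℂ (a i) (u j) = inner ℂ (u i) (a j))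
    (hB : ∀ i j, inner ℂ (b i) (u j) = inner ℂ (u i) (b j))
    (h0 : a 0 = e 0 • u 0)
    (hrec : ∀ n, a (n + 1) + b n = ∑ p ∈ Finset.HasAntidiagonal.antidiagonal (n + 1), e p.1 • u p.2) (n : ℕ) :
    starRingEnd ℂ (e n) = e n := by
  -- The formal equation `(A + t V) u = e u`, paired with `u` on the left. By symmetry the left-hand
  -- side is its own conjugate.
  have key : innerSeries u a + PowerSeries.X * innerSeries u b
      = PowerSeries.mk e * innerSeries u u := by
    rw [← innerSeries_conv]
    ext n
    cases n with
    | zero => simp [innerSeries, h0]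
    | succ n =>
      rw [map_add, PowerSeries.coeff_succ_X_mul]
      simp only [innerSeries, PowerSeries.coeff_mk]
      rw [Finset.Nat.sum_antidiagonal_succ', Finset.Nat.sum_antidiagonal_succ']
      simp only [← hrec, inner_add_right, Finset.sum_add_distrib, h0]
      simp
      ring
  have hconj := congrArg (PowerSeries.map (starRingEnd ℂ)) key
  have hsa : innerSeries a u = innerSeries u a := by
    ext n; simp only [innerSeries, PowerSeries.coeff_mk, hA]
  have hsb : innerSeries b u = innerSeries u b := by
    ext n; simp only [innerSeries, PowerSeries.coeff_mk, hB]
  rw [map_add, map_mul, map_mul, PowerSeries.map_X, map_conj_innerSeries, map_conj_innerSeries,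
    map_conj_innerSeries, hsa, hsb, key] at hconj
  -- `⟨u, u⟩` has constant coefficient `‖u 0‖² = 1`, so it can be cancelled in the integral domain
  -- of power series.
  have hne : innerSeries u u ≠ 0 := by
    intro h
    have := congrArg (PowerSeries.coeff 0) h
    simp [innerSeries, inner_self_eq_norm_sq_to_K, hu] at this
  have := congrArg (PowerSeries.coeff n) (mul_right_cancel₀ hne hconj)
  simpa using this.symm

/-- `A` and `V` are relations rather than maps, so that unbounded operators enter only through pairs
in their graphs. `hR` is the solvability of each order after subtraction of the component along
`u₀`, and this component determines the next eigenvalue coefficient. No orthogonality of the later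
terms to `u₀` is imposed. Symmetry of `V` is asked only on the spaces `P j`, because it is available
only for finite particle vectors. -/
theorem exists_formal_eigenvector (A V : E → E → Prop) (P : ℕ → Submodule ℂ E)
    (hP : ∀ j, P (j + 2) = P j) {u₀ : E} {e₀ : ℝ} (hu₀ : u₀ ∈ P 0) (hn : ‖u₀‖ = 1)
    (horth : ∀ w ∈ P 1, inner ℂ u₀ w = 0) (hA₀ : A u₀ ((e₀ : ℂ) • u₀))
    (hV : ∀ j, ∀ w ∈ P j, ∃ y ∈ P (j + 1), V w y)
    (hR : ∀ j, ∀ w ∈ P j, ∃ u ∈ P j, A u ((e₀ : ℂ) • u + w - inner ℂ u₀ w • u₀))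
    (hAs : ∀ u a u' a', A u a → A u' a' → inner ℂ a u' = inner ℂ u a')
    (hVs : ∀ i j, ∀ u ∈ P i, ∀ u' ∈ P j, ∀ a a', V u a → V u' a' →
      inner ℂ a u' = inner ℂ u a') :
    ∃ (u a b : ℕ → E) (e : ℕ → ℝ), u 0 = u₀ ∧ e 0 = e₀ ∧ (∀ n, u n ∈ P n) ∧
      (∀ n, Odd n → e n = 0) ∧ (∀ n, A (u n) (a n)) ∧ (∀ n, V (u n) (b n)) ∧
      a 0 = (e₀ : ℂ) • u₀ ∧
      ∀ n, a (n + 1) + b n = ∑ p ∈ Finset.HasAntidiagonal.antidiagonal (n + 1), (e p.1 : ℂ) • u p.2 := by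
  choose! v hvP hv using hV
  choose! R hRP hR using hR
  have hPadd : ∀ k j, P (j + 2 * k) = P j := by
    intro k j
    induction k with
    | zero => rfl
    | succ k ih => rw [← ih, ← hP (j + 2 * k)]; rfl
  set s := rayleighSeq v R u₀ (e₀ : ℂ) with hs
  set u : ℕ → E := fun n => (s n).1 with hu
  set e : ℕ → ℂ := fun n => (s n).2 with he
  set w : ℕ → E := fun n => -(v n (u n)) + ∑ i : Fin n, e (i + 1) • u (n - i) with hw
  have hu0 : u 0 = u₀ := by simp only [hu, hs, rayleighSeq]
  have he0 : e 0 = e₀ := by simp only [he, hs, rayleighSeq]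
  have hus : ∀ n, u (n + 1) = R (n + 1) (w n) := fun n => by
    simp only [hu, hw, he, hs]; rw [rayleighSeq]
  have hes : ∀ n, e (n + 1) = -inner ℂ u₀ (w n) := fun n => by
    simp only [hu, hw, he, hs]; rw [rayleighSeq]
  -- The two claims need each other. In `w n` the terms with `i + 1` odd drop out since `e (i + 1) =
  -- 0`, and for `i + 1` even `n - i` has the parity of `n + 1`; so `w n ∈ P (n + 1)`, which for `n
  -- + 1` odd is orthogonal to `u₀`.
  have main : ∀ n, u n ∈ P n ∧ (Odd n → e n = 0) := by
    intro n
    induction n using Nat.strong_induction_on with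
    | _ n ih =>
      cases n with
      | zero => exact ⟨hu0 ▸ hu₀, fun h => absurd h (by decide)⟩
      | succ n =>
        have hwn : w n ∈ P (n + 1) := by
          refine add_mem (neg_mem (hvP n _ (ih n (by omega)).1)) (sum_mem fun i _ => ?_)
          rcases Nat.even_or_odd (i.1 + 1) with hi | hi
          · obtain ⟨k, hk⟩ := hi
            have := (ih (n - i) (by omega)).1
            rw [← hPadd k, show n - i.1 + 2 * k = n + 1 by omega] at this
            exact Submodule.smul_mem _ _ this
          · rw [(ih (i + 1) (by omega)).2 hi, zero_smul]
            exact zero_mem _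
        refine ⟨hus n ▸ hRP _ _ hwn, fun ho => ?_⟩
        obtain ⟨k, hk⟩ := ho
        rw [show n + 1 = 1 + 2 * k by omega, hPadd] at hwn
        rw [hes, horth _ hwn, neg_zero]
  have hwP : ∀ n, w n ∈ P (n + 1) := fun n => by
    refine add_mem (neg_mem (hvP n _ (main n).1)) (sum_mem fun i _ => ?_)
    rcases Nat.even_or_odd (i.1 + 1) with hi | hi
    · obtain ⟨k, hk⟩ := hi
      have := (main (n - i)).1
      rw [← hPadd k, show n - i.1 + 2 * k = n + 1 by omega] at this
      exact Submodule.smul_mem _ _ this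
    · rw [(main (i + 1)).2 hi, zero_smul]
      exact zero_mem _
  let a : ℕ → E := fun n => Nat.casesOn n ((e₀ : ℂ) • u₀)
    fun n => (e₀ : ℂ) • u (n + 1) + w n - inner ℂ u₀ (w n) • u₀
  let b : ℕ → E := fun n => v n (u n)
  have hA : ∀ n, A (u n) (a n) := by
    intro n
    cases n with
    | zero => rw [hu0]; exact hA₀
    | succ n =>
      have := hR (n + 1) (w n) (hwP n)
      rw [← hus] at this
      exact this
  have hB : ∀ n, V (u n) (b n) := fun n => hv n _ (main n).1
  have hrec : ∀ n, a (n + 1) + b n = ∑ p ∈ Finset.HasAntidiagonal.antidiagonal (n + 1), e p.1 • u p.2 := by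
    intro n
    -- The two extreme terms are split off: `e 0 • u (n + 1)` belongs to the resolvent equation and
    -- `e (n + 1) • u 0` is the projection it subtracts. The middle terms are those of `w n`.
    rw [Finset.Nat.sum_antidiagonal_eq_sum_range_succ (fun i j => e i • u j),
      Finset.sum_range_succ, Finset.sum_range_succ', ← Fin.sum_univ_eq_sum_range
      (fun i => e (i + 1) • u (n + 1 - (i + 1)))]
    have hwn : w n = -(b n) + ∑ i : Fin n, e (i + 1) • u (n - i) := rfl
    have han : a (n + 1) = (e₀ : ℂ) • u (n + 1) + w n - inner ℂ u₀ (w n) • u₀ := rfl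
    rw [han, hes, Nat.sub_self, Nat.sub_zero, hu0, he0]
    simp only [Nat.add_sub_add_right]
    rw [eq_sub_of_add_eq' hwn.symm]
    module
  have hreal : ∀ n, (((e n).re : ℝ) : ℂ) = e n := fun n =>
    Complex.conj_eq_iff_re.1 (conj_eq_of_formal_eigen (by rw [hu0, hn])
      (fun i j => hAs _ _ _ _ (hA i) (hA j))
      (fun i j => hVs i j _ (main i).1 _ (main j).1 _ _ (hB i) (hB j))
      (by rw [hu0, he0]; rfl) hrec n)
  refine ⟨u, a, b, fun n => (e n).re, hu0, by simp [he0], fun n => (main n).1,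
    fun n hn => by simp [(main n).2 hn], hA, hB, rfl, fun n => ?_⟩
  simp only [hreal]
  exact hrec n

/-! ### Truncated expansions -/

/-- `g` is a polynomial with vector coefficients, divisible by `t ^ d`. -/
def IsPolyTail (d : ℕ) (g : ℝ → E) : Prop :=
  ∃ (K : ℕ) (f : ℕ → E), ∀ t, g t = ∑ k ∈ Finset.range (K + 1), ((t ^ (d + k) : ℝ) : ℂ) • f k

theorem isPolyTail_pow {d m : ℕ} (h : d ≤ m) (y : E) :
    IsPolyTail d fun t => ((t ^ m : ℝ) : ℂ) • y := by
  refine ⟨m - d, Pi.single (m - d) y, fun t => ?_⟩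
  rw [Finset.sum_eq_single (m - d)]
  · simp [Nat.add_sub_cancel' h]
  · intro b _ hb
    simp [hb]
  · simp

theorem IsPolyTail.add {d : ℕ} {g g' : ℝ → E} (hg : IsPolyTail d g) (hg' : IsPolyTail d g') :
    IsPolyTail d fun t => g t + g' t := by
  obtain ⟨K, f, h⟩ := hg
  obtain ⟨K', f', h'⟩ := hg'
  -- Padding with zero coefficients brings both polynomials to a common length.
  have ext : ∀ (L M : ℕ) (y : ℕ → E) (t : ℝ), L ≤ M →
      ∑ k ∈ Finset.range (L + 1), ((t ^ (d + k) : ℝ) : ℂ) • y k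
        = ∑ k ∈ Finset.range (M + 1), ((t ^ (d + k) : ℝ) : ℂ) • if k ≤ L then y k else 0 := by
    intro L M y t hLM
    rw [← Finset.sum_subset (Finset.range_mono (Nat.succ_le_succ hLM))]
    · refine Finset.sum_congr rfl fun k hk => ?_
      rw [if_pos (by simpa [Nat.lt_succ_iff] using hk)]
    · intro k _ hk
      rw [if_neg (by simpa [Nat.lt_succ_iff] using hk), smul_zero]
  refine ⟨max K K', fun k => (if k ≤ K then f k else 0) + (if k ≤ K' then f' k else 0),
    fun t => ?_⟩
  beta_reduce
  rw [h, h', ext K _ f t (le_max_left K K'), ext K' _ f' t (le_max_right K K')]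
  simp only [smul_add, Finset.sum_add_distrib]

theorem isPolyTail_sum {ι : Type*} {d : ℕ} (s : Finset ι) {g : ι → ℝ → E}
    (h : ∀ i ∈ s, IsPolyTail d (g i)) : IsPolyTail d fun t => ∑ i ∈ s, g i t := by
  classical
  induction s using Finset.induction_on with
  | empty => exact ⟨0, 0, fun t => by simp⟩
  | insert i s hi ih =>
    simp only [Finset.sum_insert hi]
    exact (h i (Finset.mem_insert_self _ _)).add
      (ih fun j hj => h j (Finset.mem_insert_of_mem hj))

/-- The residual of a truncated formal eigenvector is of the order of the first neglected term. -/
theorem isPolyTail_residual {u a b : ℕ → E} {e : ℕ → ℝ} (h0 : a 0 = (e 0 : ℂ) • u 0)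
    (hrec : ∀ n, a (n + 1) + b n = ∑ p ∈ Finset.HasAntidiagonal.antidiagonal (n + 1), (e p.1 : ℂ) • u p.2)
    (n m : ℕ) (hm : ∀ i, m < i → i ≤ n → e i = 0) :
    IsPolyTail (n + 1) fun t =>
      ∑ j ∈ Finset.range (n + 1), ((t ^ j : ℝ) : ℂ) • (a j + (t : ℂ) • b j)
        - (∑ i ∈ Finset.range (m + 1), (e i : ℂ) * ((t ^ i : ℝ) : ℂ))
          • ∑ j ∈ Finset.range (n + 1), ((t ^ j : ℝ) : ℂ) • u j := by
  -- The coefficient of `t ^ j` is `a j + b (j - 1)`, given by `hrec`; only `b n`, at order `n + 1`,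
  -- has no partner.
  have hsum : ∀ t : ℝ, ∑ j ∈ Finset.range (n + 1), ((t ^ j : ℝ) : ℂ) • (a j + (t : ℂ) • b j)
      = ((t ^ (n + 1) : ℝ) : ℂ) • b n + ∑ j ∈ Finset.range (n + 1),
        ∑ p ∈ Finset.HasAntidiagonal.antidiagonal j, ((t ^ j : ℝ) : ℂ) • (e p.1 : ℂ) • u p.2 := by
    intro t
    clear hm
    induction n with
    | zero => simp [h0, add_comm]
    | succ n ih =>
      rw [Finset.sum_range_succ, ih, Finset.sum_range_succ _ (n + 1), ← Finset.smul_sum,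
        ← hrec n]
      push_cast
      simp only [pow_succ]
      module
  -- In the product of the truncated eigenvalue and eigenvector, the pairs of total degree at most
  -- `n` cancel and the others have degree above `n`.
  have hdiff : ∀ t : ℝ, ∑ j ∈ Finset.range (n + 1), ((t ^ j : ℝ) : ℂ) • (a j + (t : ℂ) • b j)
        - (∑ i ∈ Finset.range (m + 1), (e i : ℂ) * ((t ^ i : ℝ) : ℂ))
          • ∑ j ∈ Finset.range (n + 1), ((t ^ j : ℝ) : ℂ) • u j
      = ((t ^ (n + 1) : ℝ) : ℂ) • b n
        + ∑ p ∈ (Finset.range (m + 1) ×ˢ Finset.range (n + 1)).filter fun p => n < p.1 + p.2,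
          ((t ^ (p.1 + p.2) : ℝ) : ℂ) • (-((e p.1 : ℂ) • u p.2)) := by
    intro t
    have hprod : (∑ i ∈ Finset.range (m + 1), (e i : ℂ) * ((t ^ i : ℝ) : ℂ))
          • ∑ j ∈ Finset.range (n + 1), ((t ^ j : ℝ) : ℂ) • u j
        = ∑ p ∈ Finset.range (m + 1) ×ˢ Finset.range (n + 1),
          ((t ^ (p.1 + p.2) : ℝ) : ℂ) • ((e p.1 : ℂ) • u p.2) := by
      rw [Finset.sum_smul, Finset.sum_product]
      refine Finset.sum_congr rfl fun i _ => ?_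
      rw [Finset.smul_sum]
      refine Finset.sum_congr rfl fun j _ => ?_
      simp only [smul_smul, pow_add]
      push_cast
      ring_nf
    -- The antidiagonals also contain pairs with first index above `m`, absent from the product;
    -- `hm` makes their coefficients zero.
    have hlow : ∑ j ∈ Finset.range (n + 1),
          ∑ p ∈ Finset.HasAntidiagonal.antidiagonal j, ((t ^ j : ℝ) : ℂ) • (e p.1 : ℂ) • u p.2
        = ∑ p ∈ (Finset.range (m + 1) ×ˢ Finset.range (n + 1)).filter
            fun p => ¬ n < p.1 + p.2,
          ((t ^ (p.1 + p.2) : ℝ) : ℂ) • ((e p.1 : ℂ) • u p.2) := by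
      rw [Finset.sum_sigma']
      symm
      refine Finset.sum_of_injOn (fun p => ⟨p.1 + p.2, p⟩) ?_ ?_ ?_ ?_
      · intro p _ q _ h
        simpa using (Sigma.mk.inj_iff.1 h).2
      · intro p hp
        simp only [Finset.coe_filter, Finset.mem_product, Finset.mem_range, Set.mem_ofPred_eq] at hp
        simp only [Finset.coe_sigma, Set.mem_sigma_iff, Finset.mem_coe, Finset.mem_range,
          Finset.HasAntidiagonal.mem_antidiagonal, and_true]
        omega
      · rintro ⟨j, p⟩ hp hn
        simp only [Finset.mem_sigma, Finset.mem_range, Finset.HasAntidiagonal.mem_antidiagonal] at hp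
        rw [hm p.1 ?_ (by omega)]
        · simp
        · by_contra hlt
          refine hn ⟨p, ?_, ?_⟩
          · simp only [Finset.coe_filter, Finset.mem_product, Finset.mem_range, Set.mem_ofPred_eq]
            omega
          · simp [hp.2]
      · intro p _
        rfl
    rw [hsum, hprod, hlow, ← Finset.sum_filter_add_sum_filter_not
      (Finset.range (m + 1) ×ˢ Finset.range (n + 1)) fun p => n < p.1 + p.2]
    simp only [smul_neg, Finset.sum_neg_distrib]
    abel
  simp only [hdiff]
  refine (isPolyTail_pow le_rfl _).add (isPolyTail_sum _ fun p hp => isPolyTail_pow ?_ _)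
  simp only [Finset.mem_filter] at hp
  omega

end FormalPerturbation

/-! ### Permutations and removal of an index -/

/-- `σ` restricts to a bijection from the complement of `i` to the complement of `σ i`. The type `α`
is quantified after `τ` because one permutation must act on the momenta and on the polarization
indices simultaneously. -/
theorem exists_perm_removeNth {n : ℕ} (σ : Equiv.Perm (Fin (n + 1))) (i : Fin (n + 1)) :
    ∃ τ : Equiv.Perm (Fin n), ∀ {α : Type} (x : Fin (n + 1) → α),
      i.removeNth (x ∘ σ) = (σ i).removeNth x ∘ τ := by
  have h : ∀ j : Fin n, ∃ l : Fin n, (σ i).succAbove l = σ (i.succAbove j) := fun j =>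
    Fin.exists_succAbove_eq fun he => Fin.succAbove_ne i j (σ.injective he)
  choose τ hτ using h
  have hinj : Function.Injective τ := fun a b hab => by
    have := hτ a
    rw [hab, hτ b] at this
    exact (Fin.succAbove_right_injective (σ.injective this)).symm
  refine ⟨Equiv.ofBijective τ (Finite.injective_iff_bijective.1 hinj), fun x => ?_⟩
  funext j
  simp [Fin.removeNth, hτ]

theorem exists_perm_cons {n : ℕ} (σ : Equiv.Perm (Fin n)) :
    ∃ τ : Equiv.Perm (Fin (n + 1)), ∀ {α : Type} (y : α) (x : Fin n → α),
      (Fin.cons y (x ∘ σ) : Fin (n + 1) → α) = (Fin.cons y x : Fin (n + 1) → α) ∘ τ := by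
  refine ⟨Equiv.Perm.decomposeFin.symm (0, σ), fun y x => ?_⟩
  funext j
  refine Fin.cases ?_ (fun j => ?_) j
  · simp
  · simp

theorem mp_perm {m : ℕ} (σ : Equiv.Perm (Fin m)) :
    MeasurePreserving (fun k : Fin m → R3 => k ∘ σ) volume volume :=
  (volume_measurePreserving_piCongrLeft (fun _ : Fin m => R3) σ).symm

theorem measurableEmbedding_perm {m : ℕ} (σ : Equiv.Perm (Fin m)) :
    MeasurableEmbedding (fun k : Fin m → R3 => k ∘ σ) :=
  (MeasurableEquiv.piCongrLeft (fun _ : Fin m => R3) σ).symm.measurableEmbedding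

theorem qmp_eval {n : ℕ} (i : Fin n) :
    Measure.QuasiMeasurePreserving (fun k : Fin n → R3 => k i) volume volume := by
  cases n with
  | zero => exact i.elim0
  | succ n =>
    have h := (volume_preserving_piFinSuccAbove (fun _ : Fin (n + 1) => R3) i).quasiMeasurePreserving
    exact Measure.quasiMeasurePreserving_fst.comp h

/-! ### Square integrable functions on products -/

theorem MeasureTheory.MemLp.mul_prod_two {α β : Type*} [MeasurableSpace α] [MeasurableSpace β]
    {μ : Measure α} {ν : Measure β} [SFinite μ] [SFinite ν] {f : α → ℂ} {g : β → ℂ}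
    (hf : MemLp f 2 μ) (hg : MemLp g 2 ν) :
    MemLp (fun z : α × β => f z.1 * g z.2) 2 (μ.prod ν) := by
  have hm : AEStronglyMeasurable (fun z : α × β => f z.1 * g z.2) (μ.prod ν) :=
    (hf.1.comp_quasiMeasurePreserving Measure.quasiMeasurePreserving_fst).mul
      (hg.1.comp_quasiMeasurePreserving Measure.quasiMeasurePreserving_snd)
  rw [memLp_two_iff_integrable_sq_norm hm]
  simp only [norm_mul, mul_pow]
  exact ((memLp_two_iff_integrable_sq_norm hf.1).1 hf).mul_prod
    ((memLp_two_iff_integrable_sq_norm hg.1).1 hg)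

theorem norm_integral_mul_sq_le {α : Type*} [MeasurableSpace α] {μ : Measure α} {f g : α → ℂ}
    (hf : MemLp f 2 μ) (hg : MemLp g 2 μ) :
    ‖∫ x, f x * g x ∂μ‖ ^ 2 ≤ (∫ x, ‖f x‖ ^ 2 ∂μ) * ∫ x, ‖g x‖ ^ 2 ∂μ := by
  have h1 : ‖∫ x, f x * g x ∂μ‖ ≤ ∫ x, ‖f x‖ * ‖g x‖ ∂μ := by
    simpa only [norm_mul] using norm_integral_le_integral_norm fun x => f x * g x
  have h2 := integral_mul_le_Lp_mul_Lq_of_nonneg (μ := μ) Real.HolderConjugate.two_two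
    (ae_of_all _ fun x => norm_nonneg (f x)) (ae_of_all _ fun x => norm_nonneg (g x))
    (by simpa using hf.norm) (by simpa using hg.norm)
  simp only [Real.rpow_two, ← Real.sqrt_eq_rpow] at h2
  have hF : 0 ≤ ∫ x, ‖f x‖ ^ 2 ∂μ := integral_nonneg fun x => by positivity
  have hG : 0 ≤ ∫ x, ‖g x‖ ^ 2 ∂μ := integral_nonneg fun x => by positivity
  calc ‖∫ x, f x * g x ∂μ‖ ^ 2
      ≤ (√(∫ x, ‖f x‖ ^ 2 ∂μ) * √(∫ x, ‖g x‖ ^ 2 ∂μ)) ^ 2 :=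
        pow_le_pow_left₀ (norm_nonneg _) (h1.trans h2) 2
    _ = _ := by rw [mul_pow, Real.sq_sqrt hF, Real.sq_sqrt hG]

/-- Cauchy-Schwarz in `x` for almost every `y`, then Fubini. This is what makes annihilation map one
photon sector into the next lower one. -/
theorem MeasureTheory.MemLp.integral_mul_prod {α β : Type*} [MeasurableSpace α]
    [MeasurableSpace β] {μ : Measure α} {ν : Measure β} [SFinite μ] [SFinite ν] {f : α → ℂ}
    {F : α × β → ℂ} (hf : MemLp f 2 μ) (hF : MemLp F 2 (μ.prod ν)) :
    MemLp (fun y => ∫ x, f x * F (x, y) ∂μ) 2 ν := by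
  have hm0 : AEStronglyMeasurable (fun z : α × β => f z.1 * F z) (μ.prod ν) :=
    (hf.1.comp_quasiMeasurePreserving Measure.quasiMeasurePreserving_fst).mul hF.1
  have hm : AEStronglyMeasurable (fun y => ∫ x, f x * F (x, y) ∂μ) ν :=
    hm0.prod_swap.integral_prod_right'
  have h2 := (memLp_two_iff_integrable_sq_norm hF.1).1 hF
  rw [memLp_two_iff_integrable_sq_norm hm]
  refine (h2.integral_prod_right.const_mul (∫ x, ‖f x‖ ^ 2 ∂μ)).mono' (hm.norm.pow 2) ?_
  filter_upwards [h2.prod_left_ae, hF.1.prodMk_right] with y h3 h4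
  rw [Real.norm_of_nonneg (by positivity)]
  exact norm_integral_mul_sq_le hf ((memLp_two_iff_integrable_sq_norm h4).2 h3)

/-! ### Construction of elements of the photon sectors -/

/-- Turns an almost everywhere formula into an element of the sector; creation, annihilation and
functions of the energy are all realized through it. -/
theorem exists_photonSector {m : ℕ} {F : (Fin m → R3) → (Fin m → Fin 3) → ℂ}
    (hF : ∀ a, MemLp (fun k => F k a) 2 volume)
    (hs : ∀ σ : Equiv.Perm (Fin m), ∀ᵐ k, ∀ a, F (k ∘ σ) (a ∘ σ) = F k a)
    (ht : ∀ i : Fin m, ∀ᵐ k, ∀ a, ∑ j : Fin 3, (k i j : ℂ) * F k (Function.update a i j) = 0) :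
    ∃ f : photonSector m, ∀ᵐ k, ∀ a, (f : Lp (Pol m) 2 volume) k a = F k a := by
  have hL : MemLp (fun k => (WithLp.toLp 2 (F k) : Pol m)) 2 volume := MemLp.of_eval_piLp hF
  have hc : ∀ᵐ k, ∀ a, hL.toLp _ k a = F k a := by
    filter_upwards [hL.coeFn_toLp] with k hk a
    rw [hk]
  refine ⟨⟨hL.toLp _, fun σ => ?_, fun i => ?_⟩, hc⟩
  · filter_upwards [hc, (qmp_perm σ).ae hc, hs σ] with k h1 h2 h3 a
    rw [h1, h2, h3]
  · filter_upwards [hc, ht i] with k h1 h2 a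
    simp only [h1, h2]

theorem exists_photonFock {y : ∀ m, photonSector m} {n : ℕ} (h : ∀ m, n < m → y m = 0) :
    ∃ Y : PhotonFock, ∀ m, Y m = y m := by
  -- Exponent `0` encodes finite support, which implies membership for every larger exponent.
  have h0 : Memℓp y 0 := memℓp_zero ((Set.finite_Iic n).subset fun m hm => by
    by_contra hlt
    exact hm (h m (by simpa using hlt)))
  exact ⟨⟨y, h0.of_exponent_ge zero_le⟩, fun m => rfl⟩

theorem photonSector_eq_zero {m : ℕ} {f : photonSector m}
    (h : ∀ᵐ k, ∀ a, f.1 k a = 0) : f = 0 := by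
  apply Subtype.ext
  apply Lp.ext
  filter_upwards [h, Lp.coeFn_zero (Pol m) 2 (volume : Measure (Fin m → R3))] with k hk h0
  ext a
  simpa [h0] using hk a

theorem component_symm (f : PhotonFock) {m : ℕ} (σ : Equiv.Perm (Fin m)) :
    ∀ᵐ k, ∀ a, component f m (k ∘ σ) (a ∘ σ) = component f m k a := (f m).2.1 σ

theorem component_transverse (f : PhotonFock) {m : ℕ} (i : Fin m) :
    ∀ᵐ k, ∀ a, ∑ j : Fin 3, (k i j : ℂ) * component f m k (Function.update a i j) = 0 :=
  (f m).2.2 i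

theorem component_of_eq_zero {f : PhotonFock} {m : ℕ} (h : f m = 0) :
    ∀ᵐ k, ∀ a, component f m k a = 0 := by
  filter_upwards [Lp.coeFn_zero (Pol m) 2 (volume : Measure (Fin m → R3))] with k hk a
  rw [component, h]
  exact congrArg (fun w : Pol m => w a) hk

theorem memLp_onePhoton (v : onePhotonSpace) (j : Fin 3) :
    MemLp (fun q => (v : Lp C3 2 (volume : Measure R3)) q j) 2 volume := by
  have h := Lp.memLp (v : Lp C3 2 (volume : Measure R3))
  refine h.of_le ?_ (ae_of_all _ fun k => PiLp.norm_apply_le _ j)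
  exact (EuclideanSpace.proj (𝕜 := ℂ) j).continuous.comp_aestronglyMeasurable h.1

theorem memLp_conj_onePhoton (v : onePhotonSpace) (j : Fin 3) :
    MemLp (fun q => starRingEnd ℂ ((v : Lp C3 2 (volume : Measure R3)) q j)) 2 volume :=
  (memLp_onePhoton v j).star

/-! ### Creation operators -/

theorem memLp_creation_term (v : onePhotonSpace) (f : PhotonFock) {n : ℕ} (i : Fin (n + 1))
    (j : Fin 3) (b : Fin n → Fin 3) :
    MemLp (fun k : Fin (n + 1) → R3 => (v : Lp C3 2 (volume : Measure R3)) (k i) j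
      * component f n (i.removeNth k) b) 2 volume :=
  ((memLp_onePhoton v j).mul_prod_two (memLp_component f n b)).comp_measurePreserving
    (volume_preserving_piFinSuccAbove (fun _ : Fin (n + 1) => R3) i)

theorem exists_creation (v : onePhotonSpace) (f : PhotonFock) (m : ℕ) :
    ∃ c : photonSector m, ∀ᵐ k, ∀ a, (c : Lp (Pol m) 2 volume) k a = creation v f m k a := by
  cases m with
  | zero =>
    refine ⟨0, ?_⟩
    filter_upwards [Lp.coeFn_zero (Pol 0) 2 (volume : Measure (Fin 0 → R3))] with k hk a
    exact congrArg (fun w : Pol 0 => w a) hk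
  | succ n =>
    refine exists_photonSector (fun a => ?_) (fun σ => ?_) (fun l => ?_)
    · exact (memLp_finsetSum _ fun i _ => memLp_creation_term v f i (a i) (i.removeNth a)).const_mul
        ((√((n : ℝ) + 1))⁻¹ : ℝ)
    · choose τ hτ using exists_perm_removeNth σ
      have h : ∀ i, ∀ᵐ k : Fin (n + 1) → R3, ∀ b,
          component f n ((σ i).removeNth k ∘ τ i) (b ∘ τ i)
            = component f n ((σ i).removeNth k) b :=
        fun i => (qmp_removeNth (σ i)).ae (component_symm f (τ i))
      filter_upwards [ae_all_iff.2 h] with k hk a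
      simp only [creation, hτ, hk, Function.comp_apply]
      congr 1
      -- Once the symmetry of `f` has absorbed the induced permutations, `σ` merely permutes the
      -- terms of the sum.
      exact Equiv.sum_comp σ fun i => (v : Lp C3 2 (volume : Measure R3)) (k i) (a i)
        * component f n (i.removeNth k) (i.removeNth a)
    · have h1 : ∀ᵐ k : Fin (n + 1) → R3,
          ∑ j, (k l j : ℂ) * (v : Lp C3 2 (volume : Measure R3)) (k l) j = 0 :=
        (qmp_eval l).ae v.2
      have h2 : ∀ i : Fin (n + 1), ∀ᵐ k : Fin (n + 1) → R3, ∀ l' a,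
          ∑ j : Fin 3, (i.removeNth k l' j : ℂ)
            * component f n (i.removeNth k) (Function.update a l' j) = 0 :=
        fun i => (qmp_removeNth i).ae (ae_all_iff.2 fun l' => component_transverse f l')
      filter_upwards [h1, ae_all_iff.2 h2] with k hk1 hk2 a
      simp only [creation, mul_left_comm _ (((√((n : ℝ) + 1))⁻¹ : ℝ) : ℂ)]
      rw [← Finset.mul_sum]
      simp only [Finset.mul_sum]
      rw [Finset.sum_comm]
      refine Finset.sum_eq_zero fun i _ => ?_
      rw [← Finset.mul_sum]
      refine mul_eq_zero_of_right _ ?_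
      -- Transversality in the `l`-th variable comes from `v` when that variable is the created
      -- photon, and from `f` otherwise.
      by_cases hil : l = i
      · subst hil
        simp only [Function.update_self, Fin.removeNth_update, ← mul_assoc]
        rw [← Finset.sum_mul, hk1, zero_mul]
      · obtain ⟨l', rfl⟩ := Fin.exists_succAbove_eq hil
        simp only [Fin.removeNth_update_succAbove, Function.update_of_ne (Ne.symm hil)]
        simp only [mul_left_comm _ ((v : Lp C3 2 (volume : Measure R3)) (k i) (a i))]
        rw [← Finset.mul_sum]
        have := hk2 i l' (i.removeNth a)
        simp only [Fin.removeNth] at this ⊢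
        rw [this, mul_zero]

/-! ### Annihilation operators -/

theorem exists_annihilation (v : onePhotonSpace) (f : PhotonFock) (m : ℕ) :
    ∃ d : photonSector m, ∀ᵐ k, ∀ a, (d : Lp (Pol m) 2 volume) k a = annihilation v f m k a := by
  refine exists_photonSector (fun a => ?_) (fun σ => ?_) (fun i => ?_)
  · have h : ∀ j : Fin 3, MemLp (fun k : Fin m → R3 => ∫ q : R3,
        starRingEnd ℂ ((v : Lp C3 2 (volume : Measure R3)) q j)
          * component f (m + 1) (Fin.cons q k) (Fin.cons j a)) 2 volume := fun j => by
      have h : MemLp (fun z : R3 × (Fin m → R3) => component f (m + 1) (Fin.cons z.1 z.2)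
          (Fin.cons j a)) 2 (volume.prod volume) :=
        (memLp_component f (m + 1) (Fin.cons j a)).comp_measurePreserving (mp_cons m)
      exact (memLp_conj_onePhoton v j).integral_mul_prod h
    simp only [annihilation]
    exact (memLp_finsetSum Finset.univ fun j _ => h j).const_mul ((√((m : ℝ) + 1) : ℝ) : ℂ)
  · obtain ⟨τ, hτ⟩ := exists_perm_cons σ
    filter_upwards [ae_ae_cons (component_symm f τ)] with k hk a
    simp only [annihilation]
    congr 1
    refine Finset.sum_congr rfl fun j _ => integral_congr_ae ?_
    filter_upwards [hk] with q hq
    rw [hτ, hτ, hq]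
  · filter_upwards [ae_ae_cons (component_transverse f i.succ), integrable_annihilation v f m]
      with k hk hI a
    simp only [annihilation, mul_left_comm _ ((√((m : ℝ) + 1) : ℝ) : ℂ)]
    rw [← Finset.mul_sum]
    simp only [Finset.mul_sum]
    rw [Finset.sum_comm]
    refine Finset.sum_eq_zero fun j _ => ?_
    rw [← Finset.mul_sum]
    refine mul_eq_zero_of_right _ ?_
    simp only [← integral_const_mul]
    rw [← integral_finsetSum _ fun l _ => (hI _ j).const_mul _]
    refine integral_eq_zero_of_ae ?_
    filter_upwards [hk] with q hq
    have := hq (Fin.cons j a)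
    simp only [Fin.cons_succ, ← Fin.cons_update] at this
    simp only [mul_left_comm _ (starRingEnd ℂ _)]
    rw [← Finset.mul_sum, this, mul_zero, Pi.zero_apply]

/-! ### Creation and annihilation are adjoint to each other -/

theorem inner_photonSector {m : ℕ} (f g : photonSector m) :
    inner ℂ f g = ∫ k, ∑ a, starRingEnd ℂ (f.1 k a) * g.1 k a := by
  rw [Submodule.coe_inner, L2.inner_def]
  refine integral_congr_ae (ae_of_all _ fun k => ?_)
  simp only [PiLp.inner_apply, RCLike.inner_apply, mul_comm]

theorem integrable_creation_term_mul (v : onePhotonSpace) (f g : PhotonFock) {n : ℕ}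
    (i : Fin (n + 1)) (j : Fin 3) (b : Fin n → Fin 3) (a : Fin (n + 1) → Fin 3) :
    Integrable fun k : Fin (n + 1) → R3 =>
      starRingEnd ℂ ((v : Lp C3 2 (volume : Measure R3)) (k i) j
        * component f n (i.removeNth k) b) * component g (n + 1) k a :=
  (memLp_creation_term v f i j b).star.integrable_mul (memLp_component g (n + 1) a)

/-- Since `g` is symmetric, the created photon may be moved to the first place, so the `n + 1` terms
of the creation operator contribute equally. -/
theorem integral_creation_term_mul (v : onePhotonSpace) (f g : PhotonFock) {n : ℕ}
    (i : Fin (n + 1)) :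
    ∫ k : Fin (n + 1) → R3, ∑ a : Fin (n + 1) → Fin 3,
      starRingEnd ℂ ((v : Lp C3 2 (volume : Measure R3)) (k i) (a i)
        * component f n (i.removeNth k) (i.removeNth a)) * component g (n + 1) k a
    = ∫ k : Fin (n + 1) → R3, ∑ a : Fin (n + 1) → Fin 3,
      starRingEnd ℂ ((v : Lp C3 2 (volume : Measure R3)) (k 0) (a 0)
        * component f n (Fin.tail k) (Fin.tail a)) * component g (n + 1) k a := by
  -- This cycle brings the entry `i` to the front and keeps the order of the others.
  set σ := i.cycleRange.symm with hσ
  have h0 : ∀ {α : Type} (x : Fin (n + 1) → α), (x ∘ σ) 0 = x i := fun x => by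
    rw [hσ, ← Fin.cons_removeNth_eq_comp_cycleRange_symm, Fin.cons_zero]
  have h1 : ∀ {α : Type} (x : Fin (n + 1) → α), Fin.tail (x ∘ σ) = i.removeNth x := fun x => by
    rw [hσ, ← Fin.cons_removeNth_eq_comp_cycleRange_symm, Fin.tail_cons]
  refine Eq.trans ?_ ((mp_perm σ).integral_comp (measurableEmbedding_perm σ) _)
  refine integral_congr_ae ?_
  filter_upwards [component_symm g σ] with k hk
  refine Eq.trans ?_ (Equiv.sum_comp (Equiv.arrowCongr σ.symm (Equiv.refl (Fin 3))) _)
  refine Finset.sum_congr rfl fun a _ => ?_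
  have ha : Equiv.arrowCongr σ.symm (Equiv.refl (Fin 3)) a = a ∘ σ := rfl
  rw [ha, h0, h0, h1, h1, hk]

theorem integral_creation_zero_term_mul (v : onePhotonSpace) (f g : PhotonFock) {n : ℕ}
    (j : Fin 3) (b : Fin n → Fin 3) :
    ∫ k : Fin (n + 1) → R3,
      starRingEnd ℂ ((v : Lp C3 2 (volume : Measure R3)) (k 0) j
        * component f n (Fin.tail k) b) * component g (n + 1) k (Fin.cons j b)
    = ∫ k : Fin n → R3, starRingEnd ℂ (component f n k b) *
        ∫ q : R3, starRingEnd ℂ ((v : Lp C3 2 (volume : Measure R3)) q j)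
          * component g (n + 1) (Fin.cons q k) (Fin.cons j b) := by
  have hI := integrable_creation_term_mul v f g 0 j b (Fin.cons j b)
  have hI' := (mp_cons n).integrable_comp_of_integrable hI
  have h := integral_map (mp_cons n).measurable.aemeasurable
    (((mp_cons n).map_eq).symm ▸ hI.1)
  rw [(mp_cons n).map_eq] at h
  refine h.trans ((integral_prod_symm _ hI').trans ?_)
  refine integral_congr_ae (ae_of_all _ fun k => ?_)
  beta_reduce
  rw [← integral_const_mul]
  refine integral_congr_ae (ae_of_all _ fun q => ?_)
  simp only [Function.comp_apply, map_mul, Fin.cons_zero, Fin.removeNth_zero, Fin.tail_cons]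
  ring

/-- The creation side is `n + 1` copies of its first term; Fubini in the first variable turns that
term into the annihilation integral. The normalizations match because `(n + 1) / √(n + 1) = √(n +
1)`. -/
theorem inner_creation_eq_inner_annihilation {v : onePhotonSpace} {f g : PhotonFock} {n : ℕ}
    {c : photonSector (n + 1)} {d : photonSector n}
    (hc : ∀ᵐ k, ∀ a, c.1 k a = creation v f (n + 1) k a)
    (hd : ∀ᵐ k, ∀ a, d.1 k a = annihilation v g n k a) :
    inner ℂ c (g (n + 1)) = inner ℂ (f n) d := by
  have hn : (0 : ℝ) < (n : ℝ) + 1 := by positivity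
  have hI := fun i j b a => integrable_creation_term_mul v f g (n := n) i j b a
  have hL : inner ℂ c (g (n + 1)) = ((√((n : ℝ) + 1))⁻¹ : ℝ) * ∑ i : Fin (n + 1),
      ∫ k : Fin (n + 1) → R3, ∑ a : Fin (n + 1) → Fin 3,
        starRingEnd ℂ ((v : Lp C3 2 (volume : Measure R3)) (k i) (a i)
          * component f n (i.removeNth k) (i.removeNth a)) * component g (n + 1) k a := by
    rw [inner_photonSector, ← integral_finsetSum _ fun i _ =>
      integrable_finsetSum _ fun a _ => hI i (a i) (i.removeNth a) a, ← integral_const_mul]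
    refine integral_congr_ae ?_
    filter_upwards [hc] with k hk
    rw [Finset.sum_comm, Finset.mul_sum]
    refine Finset.sum_congr rfl fun a _ => ?_
    simp only [hk, creation, map_mul, map_sum, Complex.conj_ofReal, Finset.sum_mul, mul_assoc,
      component]
  have hJ : ∀ i, _ := fun i => integral_creation_term_mul v f g (n := n) i
  simp only [hL, hJ, Finset.sum_const, Finset.card_univ, Fintype.card_fin, nsmul_eq_mul]
  have hcoef : ((√((n : ℝ) + 1))⁻¹ : ℝ) * ((n + 1 : ℕ) : ℂ) = ((√((n : ℝ) + 1) : ℝ) : ℂ) := by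
    rw [← Complex.ofReal_natCast, ← Complex.ofReal_mul]
    congr 1
    rw [inv_mul_eq_iff_eq_mul₀ (Real.sqrt_pos.2 hn).ne', Real.mul_self_sqrt hn.le]
    push_cast
    rfl
  have hI₀ : ∀ a : Fin (n + 1) → Fin 3, Integrable fun k : Fin (n + 1) → R3 =>
      starRingEnd ℂ ((v : Lp C3 2 (volume : Measure R3)) (k 0) (a 0)
        * component f n (Fin.tail k) (Fin.tail a)) * component g (n + 1) k a := fun a => by
    simpa only [Fin.removeNth_zero] using hI 0 (a 0) (Fin.tail a) a
  rw [← mul_assoc, hcoef, inner_photonSector, integral_finsetSum _ fun a _ => hI₀ a,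
    ← Equiv.sum_comp (Fin.consEquiv fun _ => Fin 3), Fintype.sum_prod_type, Finset.sum_comm]
  have hD : ∀ (b : Fin n → Fin 3) (j : Fin 3), Integrable fun k : Fin n → R3 =>
      starRingEnd ℂ (component f n k b) *
        ∫ q : R3, starRingEnd ℂ ((v : Lp C3 2 (volume : Measure R3)) q j)
          * component g (n + 1) (Fin.cons q k) (Fin.cons j b) := fun b j => by
    have h : MemLp (fun z : R3 × (Fin n → R3) => component g (n + 1) (Fin.cons z.1 z.2)
        (Fin.cons j b)) 2 (volume.prod volume) :=
      (memLp_component g (n + 1) (Fin.cons j b)).comp_measurePreserving (mp_cons n)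
    exact (memLp_component f n b).star.integrable_mul
      ((memLp_conj_onePhoton v j).integral_mul_prod h)
  refine (congrArg (_ * ·) (Finset.sum_congr rfl fun b _ =>
    (Finset.sum_congr rfl fun j _ => integral_creation_zero_term_mul v f g j b).trans
      (integral_finsetSum _ fun j _ => hD b j).symm)).trans ?_
  beta_reduce
  rw [← integral_finsetSum _ fun b _ => integrable_finsetSum _ fun j _ => hD b j,
    ← integral_const_mul]
  refine integral_congr_ae ?_
  filter_upwards [hd] with k hk
  rw [Finset.mul_sum]
  refine Finset.sum_congr rfl fun b _ => ?_
  simp only [hk, annihilation, component, Finset.mul_sum]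
  refine Finset.sum_congr rfl fun j _ => ?_
  ring

/-! ### Finite particle vectors with an infrared cutoff -/

/-- The finite particle vectors whose number of photons has the parity of `j`, and which vanish
when one of the photons has a momentum of norm at most `ρ`. -/
def paritySpace (ρ : ℝ) (j : ℕ) : Submodule ℂ PhotonFock where
  carrier := {f | (∃ n : ℕ, ∀ m, n < m → f m = 0) ∧ (∀ m, m % 2 ≠ j % 2 → f m = 0) ∧
    ∀ m, ∀ᵐ k : Fin m → R3, (∃ i, ‖k i‖ ≤ ρ) → ∀ a, component f m k a = 0}
  add_mem' {f g} hf hg := by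
    obtain ⟨⟨n, hn⟩, hp, hs⟩ := hf
    obtain ⟨⟨n', hn'⟩, hp', hs'⟩ := hg
    refine ⟨⟨max n n', fun m hm => ?_⟩, fun m hm => ?_, fun m => ?_⟩
    · rw [lp.coeFn_add, Pi.add_apply, hn m (lt_of_le_of_lt (le_max_left _ _) hm),
        hn' m (lt_of_le_of_lt (le_max_right _ _) hm), add_zero]
    · rw [lp.coeFn_add, Pi.add_apply, hp m hm, hp' m hm, add_zero]
    · filter_upwards [hs m, hs' m, component_add f g m] with k h1 h2 h3 hk a
      rw [h3, h1 hk, h2 hk, add_zero]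
  zero_mem' := ⟨⟨0, fun _ _ => rfl⟩, fun _ _ => rfl, fun m => by
    filter_upwards [component_zero m] with k h _ a using h a⟩
  smul_mem' c f hf := by
    obtain ⟨⟨n, hn⟩, hp, hs⟩ := hf
    refine ⟨⟨n, fun m hm => ?_⟩, fun m hm => ?_, fun m => ?_⟩
    · rw [lp.coeFn_smul, Pi.smul_apply, hn m hm, smul_zero]
    · rw [lp.coeFn_smul, Pi.smul_apply, hp m hm, smul_zero]
    · filter_upwards [hs m, component_smul c f m] with k h1 h3 hk a
      rw [h3, h1 hk, mul_zero]

theorem ext_component {f g : PhotonFock}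
    (h : ∀ m, ∀ᵐ k, ∀ a, component f m k a = component g m k a) : f = g := by
  ext1
  funext m
  apply Subtype.ext
  apply Lp.ext
  filter_upwards [h m] with k hk
  ext a
  exact hk a

theorem inner_eq_sum_of_finite {f g : PhotonFock} {F G : ∀ m, photonSector m}
    (hF : ∀ m, f m = F m) (hG : ∀ m, g m = G m) {M : ℕ} (h : ∀ m, M ≤ m → F m = 0 ∨ G m = 0) :
    inner ℂ f g = ∑ m ∈ Finset.range M, inner ℂ (F m) (G m) := by
  refine ((lp.inner_eq_tsum f g).trans (tsum_congr fun m =>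
    congrArg₂ (inner ℂ) (hF m) (hG m))).trans (tsum_eq_sum fun m hm => ?_)
  rcases h m (by simpa using hm) with h | h
  · rw [h, inner_zero_left]
  · rw [h, inner_zero_right]

/-! ### Segal fields on finite particle vectors -/

theorem annihilation_eq_zero (v : onePhotonSpace) {f : PhotonFock} {m : ℕ} (h : f (m + 1) = 0) :
    ∀ᵐ k, ∀ a, annihilation v f m k a = 0 := by
  filter_upwards [ae_ae_cons (component_of_eq_zero h)] with k hk a
  rw [annihilation, Finset.sum_eq_zero, mul_zero]
  intro j _
  refine integral_eq_zero_of_ae ?_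
  filter_upwards [hk] with q hq
  rw [hq, mul_zero, Pi.zero_apply]

theorem creation_eq_zero (v : onePhotonSpace) {f : PhotonFock} {m : ℕ}
    (h : ∀ n, m = n + 1 → f n = 0) : ∀ᵐ k, ∀ a, creation v f m k a = 0 := by
  cases m with
  | zero => exact ae_of_all _ fun k a => rfl
  | succ n =>
    filter_upwards [ae_all_iff.2 fun i : Fin (n + 1) =>
      (qmp_removeNth i).ae (component_of_eq_zero (h n rfl))] with k hk a
    rw [creation, Finset.sum_eq_zero, mul_zero]
    intro i _
    rw [hk, mul_zero]

theorem annihilation_eq_zero_of_cutoff (v : onePhotonSpace) {f : PhotonFock} {m : ℕ} {ρ : ℝ}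
    (h : ∀ᵐ k : Fin (m + 1) → R3, (∃ i, ‖k i‖ ≤ ρ) → ∀ a, component f (m + 1) k a = 0) :
    ∀ᵐ k : Fin m → R3, (∃ i, ‖k i‖ ≤ ρ) → ∀ a, annihilation v f m k a = 0 := by
  filter_upwards [ae_ae_cons h] with k hk hi a
  obtain ⟨i, hi⟩ := hi
  rw [annihilation, Finset.sum_eq_zero, mul_zero]
  intro j _
  refine integral_eq_zero_of_ae ?_
  filter_upwards [hk] with q hq
  rw [hq ⟨i.succ, by simpa using hi⟩, mul_zero, Pi.zero_apply]

/-- Here the cutoff of `v` is indispensable: the created photon carries the momentum profile of `v`,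
whereas annihilation only integrates out a variable and preserves the cutoff for any `v`. -/
theorem creation_eq_zero_of_cutoff {v : onePhotonSpace} {f : PhotonFock} {ρ : ℝ}
    (hv : ∀ᵐ q : R3, ‖q‖ ≤ ρ → ∀ j, (v : Lp C3 2 (volume : Measure R3)) q j = 0)
    (h : ∀ m, ∀ᵐ k : Fin m → R3, (∃ i, ‖k i‖ ≤ ρ) → ∀ a, component f m k a = 0) (m : ℕ) :
    ∀ᵐ k : Fin m → R3, (∃ i, ‖k i‖ ≤ ρ) → ∀ a, creation v f m k a = 0 := by
  cases m with
  | zero => exact ae_of_all _ fun k _ a => rfl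
  | succ n =>
    filter_upwards [ae_all_iff.2 fun i : Fin (n + 1) => (qmp_removeNth i).ae (h n),
      ae_all_iff.2 fun i : Fin (n + 1) => (qmp_eval i).ae hv] with k h1 h2 hi a
    obtain ⟨l, hl⟩ := hi
    rw [creation, Finset.sum_eq_zero, mul_zero]
    intro i _
    by_cases hil : l = i
    · rw [h2 i (hil ▸ hl), zero_mul]
    · obtain ⟨l', rfl⟩ := Fin.exists_succAbove_eq hil
      rw [h1 i ⟨l', hl⟩, mul_zero]

theorem exists_segalField {v : onePhotonSpace} {ρ : ℝ}
    (hv : ∀ᵐ q : R3, ‖q‖ ≤ ρ → ∀ j, (v : Lp C3 2 (volume : Measure R3)) q j = 0)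
    {j : ℕ} {f : PhotonFock} (hf : f ∈ paritySpace ρ j) :
    ∃ y ∈ paritySpace ρ (j + 1), (f, y) ∈ segalGraph v := by
  obtain ⟨⟨n, hn⟩, hp, hs⟩ := hf
  choose c hc using exists_creation v f
  choose d hd using exists_annihilation v f
  let y : ∀ m, photonSector m := fun m => (((√2)⁻¹ : ℝ) : ℂ) • (d m + c m)
  have hy : ∀ m, ∀ᵐ k, ∀ a, (y m).1 k a
      = ((√2)⁻¹ : ℝ) * (annihilation v f m k a + creation v f m k a) := fun m => by
    filter_upwards [hc m, hd m, Lp.coeFn_smul (((√2)⁻¹ : ℝ) : ℂ) (d m + c m).1,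
      Lp.coeFn_add (d m).1 (c m).1] with k h1 h2 h3 h4 a
    rw [← h1, ← h2]
    refine (congrArg (fun w : Pol m => w a) h3).trans ?_
    exact congrArg (fun w : Pol m => (((√2)⁻¹ : ℝ) : ℂ) * w a) h4
  -- Sector `m` of the image depends only on the sectors `m + 1` and `m - 1` of `f`: this gives both
  -- the bound `n + 1` on the photon number and the change of parity.
  have hy0 : ∀ m, f (m + 1) = 0 → (∀ l, m = l + 1 → f l = 0) → y m = 0 := fun m h1 h2 => by
    refine photonSector_eq_zero ?_
    filter_upwards [hy m, annihilation_eq_zero v h1, creation_eq_zero v h2] with k h3 h4 h5 a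
    rw [h3, h4, h5, add_zero, mul_zero]
  obtain ⟨Y, hY⟩ := exists_photonFock (y := y) (n := n + 1) fun m hm =>
    hy0 m (hn _ (by omega)) fun l hl => hn _ (by omega)
  have hYc : ∀ m, ∀ᵐ k, ∀ a, component Y m k a
      = ((√2)⁻¹ : ℝ) * (annihilation v f m k a + creation v f m k a) := fun m => by
    have h := hy m
    rw [← hY m] at h
    exact h
  refine ⟨Y, ⟨⟨n + 1, fun m hm => ?_⟩, fun m hm => ?_, fun m => ?_⟩, hYc⟩
  · rw [hY]
    exact hy0 m (hn _ (by omega)) fun l hl => hn _ (by omega)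
  · rw [hY]
    exact hy0 m (hp _ (by omega)) fun l hl => hp _ (by omega)
  · filter_upwards [hYc m, annihilation_eq_zero_of_cutoff v (hs (m + 1)),
      creation_eq_zero_of_cutoff hv hs m] with k h1 h2 h3 hk a
    rw [h1, h2 hk, h3 hk, add_zero, mul_zero]

theorem segalGraph_apply {v : onePhotonSpace} {f y : PhotonFock} (h : (f, y) ∈ segalGraph v)
    {m : ℕ} {c d : photonSector m} (hc : ∀ᵐ k, ∀ a, c.1 k a = creation v f m k a)
    (hd : ∀ᵐ k, ∀ a, d.1 k a = annihilation v f m k a) :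
    y m = (((√2)⁻¹ : ℝ) : ℂ) • (d + c) := by
  apply Subtype.ext
  apply Lp.ext
  filter_upwards [h m, hc, hd, Lp.coeFn_smul (((√2)⁻¹ : ℝ) : ℂ) (d + c).1,
    Lp.coeFn_add d.1 c.1] with k h1 h2 h3 h4 h5
  refine Eq.trans ?_ h4.symm
  ext a
  refine (h1 a).trans ?_
  rw [← h2, ← h3]
  exact (congrArg (fun w : Pol m => (((√2)⁻¹ : ℝ) : ℂ) * w a) h5).symm

/-- Summation by shift: the raising part of one vector is matched with the lowering part of the
other one sector below. The boundary terms vanish at the bottom because nothing is created in sector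
`0`, and at the top because `F'` is finite. -/
theorem sum_inner_ladder_symm {E : ℕ → Type*} [∀ m, NormedAddCommGroup (E m)]
    [∀ m, InnerProductSpace ℂ (E m)] (s : ℝ) {F F' c d c' d' : ∀ m, E m} {n : ℕ}
    (hF' : ∀ m, n < m → F' m = 0) (hc₀ : c 0 = 0) (hc₀' : c' 0 = 0)
    (h : ∀ m, inner ℂ (c (m + 1)) (F' (m + 1)) = inner ℂ (F m) (d' m))
    (h' : ∀ m, inner ℂ (c' (m + 1)) (F (m + 1)) = inner ℂ (F' m) (d m)) :
    ∑ m ∈ Finset.range (n + 2), inner ℂ ((s : ℂ) • (d m + c m)) (F' m)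
      = ∑ m ∈ Finset.range (n + 2), inner ℂ (F m) ((s : ℂ) • (d' m + c' m)) := by
  have h2 : ∀ m, inner ℂ (F (m + 1)) (c' (m + 1)) = inner ℂ (d m) (F' m) := fun m => by
    rw [← inner_conj_symm, h', inner_conj_symm]
  simp only [inner_smul_left, inner_smul_right, Complex.conj_ofReal, ← Finset.mul_sum,
    inner_add_left, inner_add_right, Finset.sum_add_distrib, ← h]
  congr 1
  rw [add_comm]
  congr 1
  · rw [Finset.sum_range_succ', Finset.sum_range_succ _ (n + 1), hc₀, inner_zero_left,
      hF' (n + 1 + 1) (by omega), inner_zero_right]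
  · rw [Finset.sum_range_succ, Finset.sum_range_succ' _ (n + 1), hc₀', inner_zero_right,
      hF' (n + 1) (by omega), inner_zero_right]
    simp only [h2]

theorem inner_segalField {v : onePhotonSpace} {f y f' y' : PhotonFock} {n : ℕ}
    (hf : ∀ m, n < m → f m = 0) (hf' : ∀ m, n < m → f' m = 0)
    (h : (f, y) ∈ segalGraph v) (h' : (f', y') ∈ segalGraph v) :
    inner ℂ y f' = inner ℂ f y' := by
  choose c hc using exists_creation v f
  choose d hd using exists_annihilation v f
  choose c' hc' using exists_creation v f'
  choose d' hd' using exists_annihilation v f'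
  have e1 := inner_eq_sum_of_finite (M := n + 2) (fun m => segalGraph_apply h (hc m) (hd m))
    (fun m => (rfl : f' m = f' m)) fun m hm => Or.inr (hf' m (by omega))
  have e2 := inner_eq_sum_of_finite (M := n + 2) (fun m => (rfl : f m = f m))
    (fun m => segalGraph_apply h' (hc' m) (hd' m)) fun m hm => Or.inl (hf m (by omega))
  exact e1.trans ((sum_inner_ladder_symm (E := fun m => photonSector m) (√2)⁻¹ hf'
    (photonSector_eq_zero (hc 0)) (photonSector_eq_zero (hc' 0))
    (fun m => inner_creation_eq_inner_annihilation (hc (m + 1)) (hd' m))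
    (fun m => inner_creation_eq_inner_annihilation (hc' (m + 1)) (hd m))).trans e2.symm)

/-! ### Functions of the field energy -/

/-- Multiplication by a real function: the integrands agree sector by sector, so no finiteness of
the photon number is needed. -/
theorem inner_dGamma {f y f' y' : PhotonFock} (h : (f, y) ∈ dGammaGraph)
    (h' : (f', y') ∈ dGammaGraph) : inner ℂ y f' = inner ℂ f y' := by
  rw [lp.inner_eq_tsum, lp.inner_eq_tsum]
  refine tsum_congr fun m => ?_
  rw [inner_photonSector, inner_photonSector]
  refine integral_congr_ae ?_
  filter_upwards [h m, h' m] with k h1 h2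
  refine Finset.sum_congr rfl fun a _ => ?_
  have h1 := h1 a
  have h2 := h2 a
  simp only [component] at h1 h2
  rw [h1, h2, map_mul, Complex.conj_ofReal]
  ring

/-- The bounded functions of `dΓ(M)`. -/
theorem exists_function_dGamma {ρ : ℝ} {φ : ℝ → ℝ} (hφ : Measurable φ) {C : ℝ}
    (hC : ∀ r, 0 ≤ r → |φ r| ≤ C) {j : ℕ} {f : PhotonFock} (hf : f ∈ paritySpace ρ j) :
    ∃ g ∈ paritySpace ρ j, ∀ m, ∀ᵐ k : Fin m → R3, ∀ a,
      component g m k a = (φ (∑ i, ‖k i‖) : ℂ) * component f m k a := by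
  obtain ⟨⟨n, hn⟩, hp, hs⟩ := hf
  have hex : ∀ m, ∃ y : photonSector m, ∀ᵐ k, ∀ a,
      (y : Lp (Pol m) 2 volume) k a = (φ (∑ i, ‖k i‖) : ℂ) * component f m k a := fun m => by
    refine exists_photonSector (fun a => ?_) (fun σ => ?_) (fun i => ?_)
    · have hm : Measurable fun k : Fin m → R3 => (φ (∑ i, ‖k i‖) : ℂ) :=
        Complex.measurable_ofReal.comp (hφ.comp (by fun_prop))
      refine ((memLp_component f m a).const_mul (C : ℂ)).of_le
        (hm.aestronglyMeasurable.mul (memLp_component f m a).1) (ae_of_all _ fun k => ?_)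
      have h0 : 0 ≤ ∑ i, ‖k i‖ := Finset.sum_nonneg fun i _ => norm_nonneg _
      rw [norm_mul, norm_mul, Complex.norm_real, Complex.norm_real, Real.norm_eq_abs,
        Real.norm_eq_abs]
      exact mul_le_mul_of_nonneg_right ((hC _ h0).trans (le_abs_self C)) (norm_nonneg _)
    · filter_upwards [component_symm f σ] with k hk a
      rw [hk]
      congr 3
      exact Equiv.sum_comp σ fun i => ‖k i‖
    · filter_upwards [component_transverse f i] with k hk a
      simp only [mul_left_comm _ (φ _ : ℂ)]
      rw [← Finset.mul_sum, hk, mul_zero]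
  choose y hy using hex
  have hy0 : ∀ m, f m = 0 → y m = 0 := fun m h => by
    refine photonSector_eq_zero ?_
    filter_upwards [hy m, component_of_eq_zero h] with k h1 h2 a
    rw [h1, h2, mul_zero]
  obtain ⟨Y, hY⟩ := exists_photonFock fun m hm => hy0 m (hn m hm)
  have hYc : ∀ m, ∀ᵐ k, ∀ a, component Y m k a
      = (φ (∑ i, ‖k i‖) : ℂ) * component f m k a := fun m => by
    have h := hy m
    rw [← hY m] at h
    exact h
  refine ⟨Y, ⟨⟨n, fun m hm => ?_⟩, fun m hm => ?_, fun m => ?_⟩, hYc⟩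
  · rw [hY, hy0 m (hn m hm)]
  · rw [hY, hy0 m (hp m hm)]
  · filter_upwards [hYc m, hs m] with k h1 h2 hk a
    rw [h1, h2 hk, mul_zero]

/-! ### The vacuum -/

/-- The measure on `(ℝ³)⁰` is a Dirac mass and there is one empty index, so the vacuum sector is `ℂ`
with its usual inner product. -/
theorem inner_of_vacuum {Ψ f : PhotonFock} (hΨ : ∀ m : ℕ, m ≠ 0 → Ψ m = 0) (k : Fin 0 → R3)
    (a : Fin 0 → Fin 3) :
    inner ℂ Ψ f = starRingEnd ℂ (component Ψ 0 k a) * component f 0 k a := by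
  have h : ∀ G : (Fin 0 → R3) → ℂ, ∫ k, G k = G k := fun G => by
    rw [volume_pi, Measure.pi_of_empty _ k, integral_dirac]
  rw [inner_eq_sum_of_finite (M := 1) (fun _ => rfl) (fun _ => rfl)
    fun m hm => Or.inl (hΨ m (by omega)), Finset.sum_range_one, inner_photonSector, h,
    Fintype.sum_unique, Unique.eq_default a]
  rfl

theorem component_zero_eq_inner_mul {Ψ : PhotonFock} (hΨ : ∀ m : ℕ, m ≠ 0 → Ψ m = 0)
    (hΨ' : ‖Ψ‖ = 1) (f : PhotonFock) (k : Fin 0 → R3) (a : Fin 0 → Fin 3) :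
    component f 0 k a = inner ℂ Ψ f * component Ψ 0 k a := by
  have h : starRingEnd ℂ (component Ψ 0 k a) * component Ψ 0 k a = 1 := by
    rw [← inner_of_vacuum hΨ, inner_self_eq_norm_sq_to_K, hΨ']
    norm_num
  rw [inner_of_vacuum hΨ k a, mul_right_comm, h, one_mul]

theorem mem_paritySpace_of_vacuum {Ψ : PhotonFock} (hΨ : ∀ m : ℕ, m ≠ 0 → Ψ m = 0) (ρ : ℝ) :
    Ψ ∈ paritySpace ρ 0 :=
  ⟨⟨0, fun m hm => hΨ m (by omega)⟩, fun m hm => hΨ m (by rintro rfl; exact hm rfl), fun m => by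
    cases m with
    | zero => exact ae_of_all _ fun k hk => hk.choose.elim0
    | succ m =>
      filter_upwards [component_of_eq_zero (hΨ (m + 1) (by omega))] with k hk _ a using hk a⟩

theorem dGamma_vacuum {Ψ : PhotonFock} (hΨ : ∀ m : ℕ, m ≠ 0 → Ψ m = 0) :
    (Ψ, (0 : PhotonFock)) ∈ dGammaGraph := fun m => by
  cases m with
  | zero =>
    filter_upwards [component_zero 0] with k hk a
    simp [hk]
  | succ m =>
    filter_upwards [component_zero (m + 1), component_of_eq_zero (hΨ (m + 1) (by omega))]
      with k h1 h2 a
    simp [h1, h2]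

/-- The reduced resolvent of `dΓ(M)` at `-c ≤ 0`, on the vectors with an infrared cutoff. -/
theorem exists_resolvent_dGamma {ρ : ℝ} (hρ : 0 < ρ) {Ψ : PhotonFock}
    (hΨ : ∀ m : ℕ, m ≠ 0 → Ψ m = 0) (hΨ' : ‖Ψ‖ = 1) {c : ℝ} (hc : 0 ≤ c) {j : ℕ}
    {w : PhotonFock} (hw : w ∈ paritySpace ρ j) :
    ∃ v ∈ paritySpace ρ j, ∃ d, (v, d) ∈ dGammaGraph ∧
      d + (c : ℂ) • v = w - if c = 0 then inner ℂ Ψ w • Ψ else 0 := by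
  -- On vectors with the cutoff the energy is either `0`, in the vacuum sector, or at least `ρ`. The
  -- value `c⁻¹` below `ρ` is the inverse needed at energy `0`; for `c = 0` the convention `0⁻¹ = 0`
  -- makes `φ` annihilate the vacuum component.
  let φ : ℝ → ℝ := fun r => if ρ ≤ r then (r + c)⁻¹ else c⁻¹
  have hφm : Measurable φ := Measurable.ite measurableSet_Ici (by fun_prop) measurable_const
  have hφ : ∀ r, 0 ≤ r → |φ r| ≤ max ρ⁻¹ c⁻¹ := fun r hr => by
    simp only [φ]
    split_ifs with h
    · rw [abs_of_nonneg (by positivity)]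
      exact le_max_of_le_left (inv_anti₀ hρ (by linarith))
    · rw [abs_of_nonneg (by positivity)]
      exact le_max_right _ _
  -- Boundedness of `r φ(r)` puts the resolvent's output in the domain of `dΓ(M)`.
  have hrφ : ∀ r, 0 ≤ r → |r * φ r| ≤ max 1 (ρ * c⁻¹) := fun r hr => by
    simp only [φ]
    split_ifs with h
    · have : 0 < r + c := by linarith
      rw [abs_of_nonneg (by positivity)]
      refine le_max_of_le_left ?_
      rw [← div_eq_mul_inv, div_le_one this]
      linarith
    · rw [abs_of_nonneg (by positivity)]
      refine le_max_of_le_right ?_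
      gcongr
      exact (not_le.1 h).le
  obtain ⟨v, hvP, hv⟩ := exists_function_dGamma hφm hφ hw
  obtain ⟨d, -, hd⟩ := exists_function_dGamma (measurable_id.mul hφm) hrφ hw
  refine ⟨v, hvP, d, fun m => ?_, ?_⟩
  · filter_upwards [hv m, hd m] with k h1 h2 a
    rw [h1, h2]
    simp only [Pi.mul_apply, id]
    push_cast
    ring
  · rw [eq_sub_iff_add_eq]
    refine ext_component fun m => ?_
    set z : PhotonFock := if c = 0 then inner ℂ Ψ w • Ψ else 0 with hz
    cases m with
    | zero =>
      have hzc : ∀ᵐ k, ∀ a, component z 0 k a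
          = if c = 0 then component w 0 k a else 0 := by
        by_cases h0 : c = 0
        · filter_upwards [component_smul (inner ℂ Ψ w) Ψ 0] with k hk a
          rw [hz, if_pos h0, if_pos h0, hk, ← component_zero_eq_inner_mul hΨ hΨ']
        · filter_upwards [component_zero 0] with k hk a
          rw [hz, if_neg h0, if_neg h0, hk]
      filter_upwards [hv 0, hd 0, hzc, component_add (d + (c : ℂ) • v) z 0,
        component_add d ((c : ℂ) • v) 0, component_smul (c : ℂ) v 0] with k h1 h2 h3 h4 h5 h6 a
      rw [h4, h5, h6, h1, h2, h3]
      by_cases h0 : c = 0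
      · simp [h0]
      · simp [h0, φ]
    | succ m =>
      have hzc : ∀ᵐ k, ∀ a, component z (m + 1) k a = 0 := by
        refine component_of_eq_zero ?_
        rw [hz]
        split_ifs
        · rw [lp.coeFn_smul, Pi.smul_apply, hΨ _ (by omega), smul_zero]
        · rfl
      filter_upwards [hv (m + 1), hd (m + 1), hzc, component_add (d + (c : ℂ) • v) z (m + 1),
        component_add d ((c : ℂ) • v) (m + 1), component_smul (c : ℂ) v (m + 1),
        hw.2.2 (m + 1)] with k h1 h2 h3 h4 h5 h6 h7 a
      rw [h4, h5, h6, h1, h2, h3, add_zero]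
      -- Either the component vanishes by the cutoff, or a single photon already brings the total
      -- energy above `ρ`.
      by_cases hk : ‖k 0‖ ≤ ρ
      · rw [h7 ⟨0, hk⟩, mul_zero, mul_zero, mul_zero, add_zero]
      · have hr : ρ ≤ ∑ i, ‖k i‖ := (not_le.1 hk).le.trans
          (Finset.single_le_sum (fun i _ => norm_nonneg (k i)) (Finset.mem_univ 0))
        have hne : (∑ i, ‖k i‖) + c ≠ 0 := by linarith
        have hone : (∑ i, ‖k i‖) * φ (∑ i, ‖k i‖) + c * φ (∑ i, ‖k i‖) = 1 := by
          simp only [φ, if_pos hr]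
          field_simp
        rw [← mul_assoc, ← add_mul]
        simp only [Pi.mul_apply, id]
        rw [← Complex.ofReal_mul, ← Complex.ofReal_add, hone, Complex.ofReal_one, one_mul]

/-! ### Diagonalization of the Zeeman term -/

/-- An eigenvector of `β · σ` for `-|β|` extends to an orthonormal basis of eigenvectors. -/
theorem exists_pauli_eigenbasis {β : R3} {b₀ : EuclideanSpace ℂ (Fin 2)} (hb₀ : ‖b₀‖ = 1)
    (hb₀' : (∑ m : Fin 3, (β m : ℂ) • pauli m) *ᵥ b₀.ofLp = (-(‖β‖ : ℂ)) • b₀.ofLp) :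
    ∃ b : Fin 2 → Fin 2 → ℂ, b 0 = b₀.ofLp ∧
      (∀ i, (∑ m : Fin 3, (β m : ℂ) • pauli m) *ᵥ b i
        = ((![-‖β‖, ‖β‖] i : ℝ) : ℂ) • b i) ∧
      ∀ s t, ∑ i, b i s * starRingEnd ℂ (b i t) = if s = t then 1 else 0 := by
  have hn : b₀ 0 * starRingEnd ℂ (b₀ 0) + b₀ 1 * starRingEnd ℂ (b₀ 1) = 1 := by
    have h := EuclideanSpace.norm_sq_eq b₀
    rw [hb₀, Fin.sum_univ_two] at h
    simp only [Complex.mul_conj, Complex.normSq_eq_norm_sq]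
    rw [← Complex.ofReal_add, ← h]
    norm_num
  have h0 := congrFun hb₀' 0
  have h1 := congrFun hb₀' 1
  simp [Matrix.mulVec, dotProduct, Fin.sum_univ_succ, pauli] at h0 h1
  have h0c := congrArg (starRingEnd ℂ) h0
  have h1c := congrArg (starRingEnd ℂ) h1
  simp only [map_add, map_mul, map_neg, Complex.conj_ofReal, Complex.conj_I] at h0c h1c
  -- The second vector is the time reversal of `b₀`. This antiunitary map reverses the sign of every
  -- Pauli matrix, hence of the eigenvalue; in coordinates this is the conjugate of the equations
  -- for `b₀`.
  refine ⟨![b₀.ofLp, ![-starRingEnd ℂ (b₀ 1), starRingEnd ℂ (b₀ 0)]], rfl, fun i => ?_,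
    fun s t => ?_⟩
  · fin_cases i
    · simpa using hb₀'
    · funext s
      fin_cases s
      · simp [Matrix.mulVec, dotProduct, Fin.sum_univ_succ, pauli]
        linear_combination h1c
      · simp [Matrix.mulVec, dotProduct, Fin.sum_univ_succ, pauli]
        linear_combination -h0c
  · fin_cases s <;> fin_cases t <;> simp [Fin.sum_univ_succ]
    · linear_combination hn
    · ring
    · ring
    · linear_combination hn

variable {N : ℕ}

theorem spinMatrix_isHermitian (j : Fin 3) (l : Fin N) : (spinMatrix j l).IsHermitian := by
  have hp : ∀ j s t, star (pauli j s t) = pauli j t s := by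
    intro j s t
    fin_cases j <;> fin_cases s <;> fin_cases t <;> simp [pauli]
  ext s t
  simp only [Matrix.conjTranspose_apply, spinMatrix, Matrix.of_apply, star_prod]
  refine Finset.prod_congr rfl fun i _ => ?_
  split_ifs
  · exact hp _ _ _
  · rw [← Matrix.conjTranspose_apply, Matrix.conjTranspose_one]

/-- The sum over configurations factors over the sites, and every factor except the one at `l` is an
identity matrix. -/
theorem sum_spinMatrix_mul_prod (j : Fin 3) (l : Fin N) (c : Fin N → Fin 2 → ℂ) (s : Config N) :
    ∑ t, spinMatrix j l s t * ∏ i, c i (t i)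
      = (pauli j *ᵥ c l) (s l) * ∏ i ∈ Finset.univ.erase l, c i (s i) := by
  simp only [spinMatrix, Matrix.of_apply, ← Finset.prod_mul_distrib]
  rw [← Fintype.piFinset_univ, ← Finset.prod_univ_sum (fun _ : Fin N => Finset.univ)
    (fun i a => (if i = l then pauli j else 1) (s i) a * c i a),
    ← Finset.mul_prod_erase _ _ (Finset.mem_univ l)]
  congr 1
  · simp [Matrix.mulVec, dotProduct]
  · refine Finset.prod_congr rfl fun i hi => ?_
    simp [Finset.ne_of_mem_erase hi, Matrix.one_apply]

/-- The operator `∑_l ∑_j β_j σ_j^{[l]}` in the spin space. -/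
def zeeman (N : ℕ) (β : R3) : Matrix (Config N) (Config N) ℂ :=
  ∑ l : Fin N, ∑ j : Fin 3, (β j : ℂ) • spinMatrix j l

theorem zeeman_isHermitian (β : R3) : (zeeman N β).IsHermitian := by
  rw [Matrix.IsHermitian, zeeman]
  simp only [Matrix.conjTranspose_sum, Matrix.conjTranspose_smul,
    (spinMatrix_isHermitian _ _).eq]
  refine Finset.sum_congr rfl fun l _ => Finset.sum_congr rfl fun j _ => ?_
  congr 1
  exact Complex.conj_ofReal _

theorem sum_zeeman_mul_prod {β : R3} {c : Fin N → Fin 2 → ℂ} {ε : Fin N → ℝ}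
    (h : ∀ l, (∑ m : Fin 3, (β m : ℂ) • pauli m) *ᵥ c l = (ε l : ℂ) • c l) (s : Config N) :
    ∑ t, zeeman N β s t * ∏ i, c i (t i) = ((∑ l, ε l : ℝ) : ℂ) * ∏ i, c i (s i) := by
  simp only [zeeman, Matrix.sum_apply, Matrix.smul_apply, smul_eq_mul, Finset.sum_mul, mul_assoc]
  rw [Finset.sum_comm]
  push_cast
  rw [Finset.sum_mul]
  refine Finset.sum_congr rfl fun l _ => ?_
  rw [Finset.sum_comm]
  simp only [← Finset.mul_sum, sum_spinMatrix_mul_prod]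
  have hl := congrFun (h l) (s l)
  rw [Matrix.sum_mulVec] at hl
  simp only [Finset.sum_apply, Matrix.smul_mulVec, Pi.smul_apply, smul_eq_mul] at hl
  simp only [← mul_assoc]
  rw [← Finset.sum_mul, hl, mul_assoc, Finset.mul_prod_erase Finset.univ (fun i => c i (s i))
    (Finset.mem_univ l)]

theorem sum_prod_mul_conj_prod {b : Fin 2 → Fin 2 → ℂ}
    (h : ∀ s t, ∑ i, b i s * starRingEnd ℂ (b i t) = if s = t then 1 else 0) (s t : Config N) :
    ∑ τ : Config N, (∏ i, b (τ i) (s i)) * starRingEnd ℂ (∏ i, b (τ i) (t i))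
      = if s = t then 1 else 0 := by
  simp only [map_prod, ← Finset.prod_mul_distrib]
  rw [← Fintype.piFinset_univ, ← Finset.prod_univ_sum (fun _ : Fin N => Finset.univ)
    (fun i a => b a (s i) * starRingEnd ℂ (b a (t i)))]
  simp only [h]
  split_ifs with hst
  · exact Finset.prod_eq_one fun i _ => by rw [hst, if_pos rfl]
  · obtain ⟨i, hi⟩ := Function.ne_iff.1 hst
    exact Finset.prod_eq_zero (Finset.mem_univ i) (if_neg hi)

/-! ### Operators in the state space -/

/-- The states whose components have the parity of `j` and the infrared cutoff `ρ`. -/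
def stateParitySpace (N : ℕ) (ρ : ℝ) (j : ℕ) : Submodule ℂ (StateSpace N) where
  carrier := {ψ | ∀ s, ψ s ∈ paritySpace ρ j}
  add_mem' hf hg s := add_mem (hf s) (hg s)
  zero_mem' _ := zero_mem _
  smul_mem' c _ hf s := Submodule.smul_mem _ c (hf s)

/-- `a = (dΓ(M) + ∑_l ∑_j β_j σ_j^{[l]}) ψ`. -/
def IsFreeImage (β : R3) (ψ a : StateSpace N) : Prop :=
  ∃ d : Config N → PhotonFock, (∀ s, (ψ s, d s) ∈ dGammaGraph) ∧
    ∀ s, a s = d s + ∑ t, zeeman N β s t • ψ t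

/-- `b = ∑_l ∑_j Φ_S(a_j(x_l) + i b_j(x_l)) σ_j^{[l]} ψ`. -/
def IsInteractionImage (χ : 𝓢(ℝ, ℝ)) (x : Fin N → R3) (ψ b : StateSpace N) : Prop :=
  ∃ y : Fin N → Fin 3 → Config N → PhotonFock,
    (∀ l j s, (ψ s, y l j s) ∈ segalGraph (fieldVector χ j (x l))) ∧
    ∀ s, b s = ∑ l, ∑ j, ∑ t, spinMatrix j l s t • y l j t

theorem sum_inner_matrix {F : Type*} [NormedAddCommGroup F] [InnerProductSpace ℂ F]
    {S : Matrix (Config N) (Config N) ℂ} (hS : S.IsHermitian) {f y f' y' : Config N → F}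
    (h : ∀ s t, inner ℂ (y s) (f' t) = inner ℂ (f s) (y' t)) :
    ∑ s, inner ℂ (∑ t, S s t • y t) (f' s) = ∑ s, inner ℂ (f s) (∑ t, S s t • y' t) := by
  simp only [sum_inner, inner_sum, inner_smul_left, inner_smul_right, h]
  rw [Finset.sum_comm]
  refine Finset.sum_congr rfl fun s _ => Finset.sum_congr rfl fun t _ => ?_
  rw [← hS.apply s t]
  rfl

theorem IsFreeImage.inner_symm {β : R3} {ψ a ψ' a' : StateSpace N} (h : IsFreeImage β ψ a)
    (h' : IsFreeImage β ψ' a') : inner ℂ a ψ' = inner ℂ ψ a' := by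
  obtain ⟨d, hd, ha⟩ := h
  obtain ⟨d', hd', ha'⟩ := h'
  rw [PiLp.inner_apply, PiLp.inner_apply]
  simp only [ha, ha', inner_add_left, inner_add_right, Finset.sum_add_distrib]
  rw [sum_inner_matrix (zeeman_isHermitian β) fun s t => rfl]
  congr 1
  exact Finset.sum_congr rfl fun s _ => inner_dGamma (hd s) (hd' s)

theorem IsInteractionImage.inner_symm {χ : 𝓢(ℝ, ℝ)} {x : Fin N → R3} {ρ : ℝ} {i j : ℕ}
    {ψ b ψ' b' : StateSpace N} (hψ : ψ ∈ stateParitySpace N ρ i)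
    (hψ' : ψ' ∈ stateParitySpace N ρ j) (h : IsInteractionImage χ x ψ b)
    (h' : IsInteractionImage χ x ψ' b') : inner ℂ b ψ' = inner ℂ ψ b' := by
  obtain ⟨y, hy, hb⟩ := h
  obtain ⟨y', hy', hb'⟩ := h'
  rw [PiLp.inner_apply, PiLp.inner_apply]
  simp only [hb, hb', sum_inner (𝕜 := ℂ) (Finset.univ : Finset (Fin N)),
    sum_inner (𝕜 := ℂ) (Finset.univ : Finset (Fin 3)),
    inner_sum (𝕜 := ℂ) (Finset.univ : Finset (Fin N)),
    inner_sum (𝕜 := ℂ) (Finset.univ : Finset (Fin 3))]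
  rw [Finset.sum_comm, Finset.sum_comm (s := (Finset.univ : Finset (Config N)))]
  refine Finset.sum_congr rfl fun l _ => ?_
  rw [Finset.sum_comm, Finset.sum_comm (s := (Finset.univ : Finset (Config N)))]
  refine Finset.sum_congr rfl fun m _ => ?_
  refine sum_inner_matrix (spinMatrix_isHermitian m l) fun s t => ?_
  obtain ⟨n, hn⟩ := (hψ s).1
  obtain ⟨n', hn'⟩ := (hψ' t).1
  exact inner_segalField (n := max n n') (fun k hk => hn k (lt_of_le_of_lt (le_max_left _ _) hk))
    (fun k hk => hn' k (lt_of_le_of_lt (le_max_right _ _) hk)) (hy l m s) (hy' l m t)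

theorem fieldVector_eq_zero {χ : 𝓢(ℝ, ℝ)} {ρ : ℝ} (hχ : ∀ t : ℝ, 0 ≤ t → t ≤ ρ → χ t = 0)
    (m : Fin 3) (x : R3) : ∀ᵐ q : R3, ‖q‖ ≤ ρ →
      ∀ j, (fieldVector χ m x : Lp C3 2 (volume : Measure R3)) q j = 0 := by
  filter_upwards [(memLp_fieldFun χ m x).coeFn_toLp] with q hq hqρ j
  refine (congrArg (fun w : C3 => w j) hq).trans ?_
  simp [fieldFun, aField, bField, formFactor, hχ _ (norm_nonneg q) hqρ]

theorem exists_isInteractionImage {χ : 𝓢(ℝ, ℝ)} {ρ : ℝ}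
    (hχ : ∀ t : ℝ, 0 ≤ t → t ≤ ρ → χ t = 0) (x : Fin N → R3) {j : ℕ} {ψ : StateSpace N}
    (hψ : ψ ∈ stateParitySpace N ρ j) :
    ∃ b ∈ stateParitySpace N ρ (j + 1), IsInteractionImage χ x ψ b := by
  have h := fun (l : Fin N) (m : Fin 3) (s : Config N) =>
    exists_segalField (fieldVector_eq_zero hχ m (x l)) (hψ s)
  choose y hyP hy using h
  exact ⟨WithLp.toLp 2 fun s => ∑ l, ∑ j, ∑ t, spinMatrix j l s t • y l j t,
    fun s => sum_mem fun l _ => sum_mem fun m _ => sum_mem fun t _ =>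
      Submodule.smul_mem _ _ (hyP l m t), y, hy, fun s => rfl⟩

/-- The rows of `B` are eigenvectors of `Z`, so the equation for the free Hamiltonian decouples into
one equation for each `τ`, with shift `e τ - e₀`; this reassembles the solutions. -/
theorem smul_sum_add_of_resolvent {F : Type*} [AddCommGroup F] [Module ℂ F]
    {Z : Matrix (Config N) (Config N) ℂ} {B : Config N → Config N → ℂ} {e : Config N → ℝ}
    (hB : ∀ τ s, ∑ t, Z s t * B τ t = (e τ : ℂ) * B τ s) (e₀ : ℝ) {d v W p : Config N → F}
    (h : ∀ τ, d τ + ((e τ - e₀ : ℝ) : ℂ) • v τ = W τ - p τ) (s : Config N)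
    {X Y : F} (hX : ∑ τ, B τ s • W τ = X) (hY : ∑ τ, B τ s • p τ = Y) :
    (e₀ : ℂ) • (∑ τ, B τ s • v τ) + X - Y
      = ∑ τ, B τ s • d τ + ∑ t, Z s t • ∑ τ, B τ t • v τ := by
  have hz : ∑ t, Z s t • ∑ τ, B τ t • v τ = ∑ τ, B τ s • (e τ : ℂ) • v τ := by
    simp only [Finset.smul_sum, smul_smul]
    rw [Finset.sum_comm]
    simp only [← Finset.sum_smul, hB, mul_comm]
  rw [hz, ← hX, ← hY, Finset.smul_sum, ← Finset.sum_add_distrib, ← Finset.sum_sub_distrib,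
    ← Finset.sum_add_distrib]
  refine Finset.sum_congr rfl fun τ _ => ?_
  have hd : d τ = W τ - p τ - ((e τ - e₀ : ℝ) : ℂ) • v τ := by rw [← h τ, add_sub_cancel_right]
  rw [hd]
  push_cast
  module

theorem sum_smul_sum_conj_smul {F : Type*} [AddCommGroup F] [Module ℂ F]
    {B : Config N → Config N → ℂ}
    (hB : ∀ s t, ∑ τ, B τ s * starRingEnd ℂ (B τ t) = if s = t then 1 else 0)
    (w : Config N → F) (s : Config N) :
    ∑ τ, B τ s • ∑ t, starRingEnd ℂ (B τ t) • w t = w s := by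
  simp only [Finset.smul_sum, smul_smul]
  rw [Finset.sum_comm]
  simp [← Finset.sum_smul, hB]

theorem sum_smul_ite_eq {F : Type*} [AddCommGroup F] [Module ℂ F]
    (B : Config N → ℂ) {c : Config N → ℝ} (hc : ∀ τ, c τ = 0 ↔ τ = 0) (q : Config N → F) :
    ∑ τ, B τ • (if c τ = 0 then q τ else 0) = B 0 • q 0 := by
  simp [hc]

theorem inner_sum_conj_smul {F : Type*} [NormedAddCommGroup F] [InnerProductSpace ℂ F]
    (B : Config N → ℂ) (Ψ : F) (w : Config N → F) :
    ∑ s, inner ℂ (B s • Ψ) (w s) = inner ℂ Ψ (∑ t, starRingEnd ℂ (B t) • w t) := by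
  simp only [inner_sum, inner_smul_right, inner_smul_left]

/-- The lowest eigenvalue of the Zeeman term is `-N |β|`, and it is simple. -/
theorem zeeman_gap {r : ℝ} (hr : 0 < r) (τ : Config N) :
    0 ≤ ∑ l, ![-r, r] (τ l) - -((N : ℝ) * r) ∧
      (∑ l, ![-r, r] (τ l) - -((N : ℝ) * r) = 0 ↔ τ = 0) := by
  -- Each spin contributes `0` or `2 r` above the minimum, so the total vanishes only if every spin
  -- is in its lowest state.
  have hsum : ∑ l, ![-r, r] (τ l) - -((N : ℝ) * r) = ∑ l, (![-r, r] (τ l) + r) := by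
    simp [Finset.sum_add_distrib]
  have hterm : ∀ a : Fin 2, 0 ≤ ![-r, r] a + r := fun a => by
    fin_cases a
    · simp
    · simp [hr.le]
  rw [hsum]
  refine ⟨Finset.sum_nonneg fun l _ => hterm _, ?_⟩
  rw [Finset.sum_eq_zero_iff_of_nonneg fun l _ => hterm _]
  constructor
  · intro h
    funext l
    have := h l (Finset.mem_univ l)
    rcases Fin.exists_fin_two.1 ⟨τ l, rfl⟩ with h0 | h1
    · exact h0
    · rw [h1] at this
      simp at this
      exact absurd this hr.ne'
  · rintro rfl l _
    simp

/-- The reduced resolvent of the free Hamiltonian at its lowest eigenvalue. -/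
theorem exists_resolvent_free {β : R3} (hβ : β ≠ 0) {ρ : ℝ} (hρ : 0 < ρ) {Ψ : PhotonFock}
    (hΨ : ∀ m : ℕ, m ≠ 0 → Ψ m = 0) (hΨ' : ‖Ψ‖ = 1) {b : Fin 2 → Fin 2 → ℂ}
    (hb : ∀ i, (∑ m : Fin 3, (β m : ℂ) • pauli m) *ᵥ b i = ((![-‖β‖, ‖β‖] i : ℝ) : ℂ) • b i)
    (hb' : ∀ s t, ∑ i, b i s * starRingEnd ℂ (b i t) = if s = t then 1 else 0)
    {u₀ : StateSpace N} (hu₀ : ∀ s, u₀ s = (∏ i, b 0 (s i)) • Ψ) {j : ℕ} {w : StateSpace N}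
    (hw : w ∈ stateParitySpace N ρ j) :
    ∃ u ∈ stateParitySpace N ρ j, IsFreeImage β u
      (((-((N : ℝ) * ‖β‖) : ℝ) : ℂ) • u + w - inner ℂ u₀ w • u₀) := by
  have hgap := zeeman_gap (N := N) (norm_pos_iff.2 hβ)
  let B : Config N → Config N → ℂ := fun τ s => ∏ i, b (τ i) (s i)
  let e : Config N → ℝ := fun τ => ∑ l, ![-‖β‖, ‖β‖] (τ l)
  have hBe : ∀ τ s, ∑ t, zeeman N β s t * B τ t = (e τ : ℂ) * B τ s := fun τ s =>
    sum_zeeman_mul_prod (fun l => hb (τ l)) s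
  let W : Config N → PhotonFock := fun τ => ∑ t, starRingEnd ℂ (B τ t) • w t
  have hW : ∀ τ, W τ ∈ paritySpace ρ j := fun τ =>
    sum_mem fun t _ => Submodule.smul_mem _ _ (hw t)
  -- `W τ` is the Fock coefficient of `w` along the spin eigenvector `B τ`. The excess Zeeman energy
  -- is the constant `c` of the resolvent, and only `τ = 0` triggers the subtraction of the vacuum.
  choose v hvP d hd hvd using fun τ => exists_resolvent_dGamma hρ hΨ hΨ' (hgap τ).1 (hW τ)
  have hinner : inner ℂ u₀ w = inner ℂ Ψ (W 0) := by
    rw [PiLp.inner_apply]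
    simp only [hu₀]
    exact inner_sum_conj_smul (B 0) Ψ w
  have hws : ∀ s, ∑ τ, B τ s • W τ = w s :=
    sum_smul_sum_conj_smul (sum_prod_mul_conj_prod hb') w
  refine ⟨WithLp.toLp 2 fun s => ∑ τ, B τ s • v τ, fun s => sum_mem fun τ _ =>
    Submodule.smul_mem _ _ (hvP τ), fun s => ∑ τ, B τ s • d τ, fun s => ?_, fun s => ?_⟩
  · have : (∑ τ, B τ s • v τ, ∑ τ, B τ s • d τ) = ∑ τ, B τ s • (v τ, d τ) := by
      simp only [Prod.ext_iff, Prod.fst_sum, Prod.snd_sum, Prod.smul_fst, Prod.smul_snd, and_self]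
    show (∑ τ, B τ s • v τ, ∑ τ, B τ s • d τ) ∈ dGammaGraph
    rw [this]
    exact sum_mem fun τ _ => Submodule.smul_mem _ _ (hd τ)
  · have hproj := sum_smul_ite_eq (fun τ => B τ s) (fun τ => (hgap τ).2)
      fun τ => inner ℂ Ψ (W τ) • Ψ
    have hu : B 0 s • inner ℂ Ψ (W 0) • Ψ = inner ℂ u₀ w • u₀ s := by
      rw [hinner, hu₀]
      exact smul_comm _ _ _
    exact smul_sum_add_of_resolvent hBe (-((N : ℝ) * ‖β‖)) hvd s (hws s) (hproj.trans hu)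

theorem isFreeImage_vacuum {β : R3} {Ψ : PhotonFock} (hΨ : ∀ m : ℕ, m ≠ 0 → Ψ m = 0)
    {b : Fin 2 → ℂ} {e : ℝ} (hb : (∑ m : Fin 3, (β m : ℂ) • pauli m) *ᵥ b = (e : ℂ) • b)
    {u₀ : StateSpace N} (hu₀ : ∀ s, u₀ s = (∏ i, b (s i)) • Ψ) :
    IsFreeImage β u₀ (((N * e : ℝ) : ℂ) • u₀) := by
  refine ⟨fun _ => 0, fun s => ?_, fun s => ?_⟩
  · rw [hu₀]
    have := dGammaGraph.smul_mem (∏ i, b (s i)) (dGamma_vacuum hΨ)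
    rwa [Prod.smul_mk, smul_zero] at this
  · have h := sum_zeeman_mul_prod (N := N) (c := fun _ => b) (ε := fun _ => e) (fun _ => hb) s
    simp only [hu₀, smul_smul, ← Finset.sum_smul, h, zero_add, PiLp.smul_apply]
    simp

/-! ### The graph of the Hamiltonian -/

section Graphs

variable {E : Type*} [AddCommGroup E] [Module ℂ E]

theorem LinearPMap.add_mem_graph {A B : E →ₗ.[ℂ] E} {u y z : E} (hA : (u, y) ∈ A.graph)
    (hB : (u, z) ∈ B.graph) : (u, y + z) ∈ (A + B).graph := by
  rw [LinearPMap.mem_graph_iff] at *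
  obtain ⟨⟨a, ha⟩, h1, h2⟩ := hA
  obtain ⟨⟨b, hb⟩, h3, h4⟩ := hB
  simp only at h1 h2 h3 h4
  subst h1
  subst h3
  exact ⟨⟨_, ha, hb⟩, rfl, by rw [← h2, ← h4]; rfl⟩

theorem LinearPMap.smul_mem_graph {A : E →ₗ.[ℂ] E} {u y : E} (hA : (u, y) ∈ A.graph) (c : ℂ) :
    (u, c • y) ∈ (c • A).graph := by
  rw [LinearPMap.mem_graph_iff] at *
  obtain ⟨⟨a, ha⟩, h1, h2⟩ := hA
  simp only at h1 h2
  subst h1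
  exact ⟨⟨a, ha⟩, rfl, by rw [← h2]; rfl⟩

theorem LinearPMap.sum_mem_graph {ι : Type*} (s : Finset ι) {A : ι → E →ₗ.[ℂ] E} {u : E}
    {y : ι → E} (h : ∀ i ∈ s, (u, y i) ∈ (A i).graph) :
    (u, ∑ i ∈ s, y i) ∈ (∑ i ∈ s, A i).graph := by
  classical
  induction s using Finset.induction_on with
  | empty =>
    rw [Finset.sum_empty, Finset.sum_empty, LinearPMap.mem_graph_iff]
    exact ⟨⟨u, trivial⟩, rfl, rfl⟩
  | insert i s hi ih =>
    rw [Finset.sum_insert hi, Finset.sum_insert hi]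
    exact LinearPMap.add_mem_graph (h i (Finset.mem_insert_self _ _))
      (ih fun j hj => h j (Finset.mem_insert_of_mem hj))

end Graphs

theorem tensorOp_mem_graph {A : PhotonFock →ₗ.[ℂ] PhotonFock}
    (S : Matrix (Config N) (Config N) ℂ) {f : StateSpace N} {g : Config N → PhotonFock}
    (h : ∀ t, (f t, g t) ∈ A.graph) :
    (f, (WithLp.toLp 2 fun s => ∑ t, S s t • g t : StateSpace N)) ∈ (tensorOp A S).graph := by
  have h' : ∀ t, ∃ ht : f t ∈ A.domain, A ⟨f t, ht⟩ = g t := fun t => by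
    obtain ⟨⟨a, ha⟩, h1, h2⟩ := (LinearPMap.mem_graph_iff _).1 (h t)
    simp only at h1 h2
    subst h1
    exact ⟨ha, h2⟩
  choose hd hv using h'
  refine (LinearPMap.mem_graph_iff _).2 ⟨⟨f, hd⟩, rfl, ?_⟩
  show (WithLp.toLp 2 fun s => ∑ t, S s t • A ⟨f t, hd t⟩ : StateSpace N) = _
  simp only [hv]

theorem scalarOp_mem_graph (c : ℂ) (f : PhotonFock) : (f, c • f) ∈ (scalarOp c).graph :=
  (LinearPMap.mem_graph_iff _).2 ⟨⟨f, trivial⟩, rfl, rfl⟩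

theorem hamiltonian_component {F : Type*} [AddCommGroup F] [Module ℂ F] (β : R3) (h r : ℂ)
    (ψ d : Config N → F) (y : Fin N → Fin 3 → Config N → F) (s : Config N) :
    ∑ t, (1 : Matrix (Config N) (Config N) ℂ) s t • h • d t
      + h • ∑ l, ∑ j, ∑ t, spinMatrix j l s t • ((β j : ℂ) • ψ t + r • y l j t)
    = h • (d s + ∑ t, zeeman N β s t • ψ t
      + r • ∑ l, ∑ j, ∑ t, spinMatrix j l s t • y l j t) := by
  have hz : ∑ t, zeeman N β s t • ψ t
      = ∑ l, ∑ j, ∑ t, spinMatrix j l s t • (β j : ℂ) • ψ t := by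
    simp only [zeeman, Matrix.sum_apply, Matrix.smul_apply, Finset.sum_smul]
    rw [Finset.sum_comm]
    refine Finset.sum_congr rfl fun l _ => ?_
    rw [Finset.sum_comm]
    refine Finset.sum_congr rfl fun j _ => Finset.sum_congr rfl fun t _ => ?_
    rw [smul_smul, smul_eq_mul, mul_comm]
  have h1 : ∑ t, (1 : Matrix (Config N) (Config N) ℂ) s t • h • d t = h • d s := by
    simp [Matrix.one_apply]
  rw [hz, h1]
  simp only [smul_add, Finset.sum_add_distrib, Finset.smul_sum, smul_comm r]
  abel

/-- The factorization `H(h) = h (A + √h V)`, which makes `√h` the perturbation parameter. It also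
shows that `ψ` lies in the domain, for every real `h`. -/
theorem hamiltonian_mem_graph {χ : 𝓢(ℝ, ℝ)} {β : R3} {x : Fin N → R3} {ψ a b : StateSpace N}
    (ha : IsFreeImage β ψ a) (hb : IsInteractionImage χ x ψ b) (h : ℝ) :
    (ψ, (h : ℂ) • (a + ((√h : ℝ) : ℂ) • b)) ∈ (hamiltonian χ β x h).graph := by
  obtain ⟨d, hd, ha⟩ := ha
  obtain ⟨y, hy, hb⟩ := hb
  have h1 : (ψ, _) ∈ (tensorOp ((h : ℂ) • dGamma) (1 : Matrix (Config N) (Config N) ℂ)).graph :=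
    tensorOp_mem_graph 1 fun t =>
      LinearPMap.smul_mem_graph (dGamma_graph.symm ▸ hd t : (ψ t, d t) ∈ dGamma.graph) h
  have h2 : (ψ, _) ∈ ((h : ℂ) • ∑ l : Fin N, ∑ j : Fin 3,
      tensorOp (scalarOp (β j : ℂ) + magneticField χ h j (x l)) (spinMatrix j l)).graph :=
    LinearPMap.smul_mem_graph (LinearPMap.sum_mem_graph _ fun l _ =>
      LinearPMap.sum_mem_graph _ fun j _ => tensorOp_mem_graph (spinMatrix j l) fun t =>
        LinearPMap.add_mem_graph (scalarOp_mem_graph (β j : ℂ) (ψ t))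
          (LinearPMap.smul_mem_graph ((segalField_graph _).symm ▸ hy l j t :
            (ψ t, y l j t) ∈ (segalField (fieldVector χ j (x l))).graph) ((√h : ℝ) : ℂ))) h
  have h3 := LinearPMap.add_mem_graph h1 h2
  have hE : (h : ℂ) • (a + ((√h : ℝ) : ℂ) • b)
      = (WithLp.toLp 2 fun s => ∑ t, (1 : Matrix (Config N) (Config N) ℂ) s t • (h : ℂ) • d t)
        + (h : ℂ) • ∑ l, ∑ j, (WithLp.toLp 2 fun s => ∑ t, spinMatrix j l s t
          • ((β j : ℂ) • ψ t + ((√h : ℝ) : ℂ) • y l j t) : StateSpace N) := by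
    ext1 s
    simp only [PiLp.add_apply, PiLp.smul_apply, WithLp.ofLp_sum, Finset.sum_apply, ha, hb]
    exact (hamiltonian_component β h ((√h : ℝ) : ℂ) ψ.ofLp d y s).symm
  rw [hE]
  exact h3

/-! ### Truncated expansions of the quasimodes -/

/-- The image of the truncated sum by the Hamiltonian, in terms of the images of the coefficients by
the two parts of the Hamiltonian. -/
theorem truncation_mem_graph {χ : 𝓢(ℝ, ℝ)} {β : R3} {x : Fin N → R3} {u a b : ℕ → StateSpace N}
    (ha : ∀ n, IsFreeImage β (u n) (a n)) (hb : ∀ n, IsInteractionImage χ x (u n) (b n)) (n : ℕ)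
    (h : ℝ) :
    (truncation u n h, ∑ j ∈ Finset.range (n + 1), ((h ^ ((j : ℝ) / 2) : ℝ) : ℂ)
      • (h : ℂ) • (a j + ((√h : ℝ) : ℂ) • b j)) ∈ (hamiltonian χ β x h).graph := by
  have hsum : (truncation u n h, ∑ j ∈ Finset.range (n + 1), ((h ^ ((j : ℝ) / 2) : ℝ) : ℂ)
      • (h : ℂ) • (a j + ((√h : ℝ) : ℂ) • b j))
      = ∑ j ∈ Finset.range (n + 1), ((h ^ ((j : ℝ) / 2) : ℝ) : ℂ)
        • (u j, (h : ℂ) • (a j + ((√h : ℝ) : ℂ) • b j)) := by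
    simp only [truncation, Prod.ext_iff, Prod.fst_sum, Prod.snd_sum, Prod.smul_fst, Prod.smul_snd,
      and_self]
  rw [hsum]
  exact sum_mem fun j _ => Submodule.smul_mem _ _ (hamiltonian_mem_graph (ha j) (hb j) h)

theorem rpow_eq_sqrt_pow {h r : ℝ} (hh : 0 < h) {n : ℕ} (hr : 2 * r = n) : h ^ r = √h ^ n := by
  rw [Real.sqrt_eq_rpow, ← Real.rpow_natCast, ← Real.rpow_mul hh.le, ← hr]
  congr 1
  ring

/-- The vanishing odd coefficients leave only even powers of `√h`; the prefactor `h` accounts for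
the shift from `j` to `j - 1`. -/
theorem approxEigenvalue_eq {e : ℕ → ℝ} (he : ∀ n, Odd n → e n = 0) (p : ℕ) {h : ℝ}
    (hh : 0 ≤ h) :
    (approxEigenvalue (fun j => e (2 * (j - 1))) p h : ℂ)
      = (h : ℂ) * ∑ i ∈ Finset.range (2 * p + 1), (e i : ℂ) * ((√h ^ i : ℝ) : ℂ) := by
  have key : approxEigenvalue (fun j => e (2 * (j - 1))) p h
      = h * ∑ i ∈ Finset.range (2 * p + 1), e i * √h ^ i := by
    induction p with
    | zero => simp [approxEigenvalue, mul_comm]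
    | succ p ih =>
      rw [approxEigenvalue, Finset.sum_Icc_succ_top (by omega), ← approxEigenvalue, ih,
        show 2 * (p + 1) + 1 = 2 * p + 1 + 1 + 1 by ring, Finset.sum_range_succ _ (2 * p + 1 + 1),
        Finset.sum_range_succ _ (2 * p + 1), he (2 * p + 1) ⟨p, rfl⟩, Nat.add_sub_cancel,
        show 2 * p + 1 + 1 = 2 * (p + 1) by ring, pow_mul, Real.sq_sqrt hh]
      ring
  rw [key]
  push_cast
  rfl

theorem smul_isPolyTail {E : Type*} [AddCommGroup E] [Module ℂ E] {u z f : ℕ → E} {n K : ℕ}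
    {h t : ℝ} (ht : t ^ 2 = h) (S : ℂ)
    (hf : ∑ j ∈ Finset.range (n + 1), ((t ^ j : ℝ) : ℂ) • z j
        - S • ∑ j ∈ Finset.range (n + 1), ((t ^ j : ℝ) : ℂ) • u j
      = ∑ k ∈ Finset.range (K + 1), ((t ^ (n + 1 + k) : ℝ) : ℂ) • f k) :
    ∑ j ∈ Finset.range (n + 1), ((t ^ j : ℝ) : ℂ) • (h : ℂ) • z j
        - ((h : ℂ) * S) • ∑ j ∈ Finset.range (n + 1), ((t ^ j : ℝ) : ℂ) • u j
      = ∑ k ∈ Finset.range (K + 1), ((t ^ (n + 3 + k) : ℝ) : ℂ) • f k := by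
  have hfac : ∀ k, ((t ^ (n + 3 + k) : ℝ) : ℂ) • f k
      = (h : ℂ) • ((t ^ (n + 1 + k) : ℝ) : ℂ) • f k := fun k => by
    rw [smul_smul, ← ht, ← Complex.ofReal_mul, ← pow_add]
    congr 3
    ring
  rw [Finset.sum_congr rfl fun k _ => hfac k, ← Finset.smul_sum, ← hf, smul_sub, mul_smul]
  congr 1
  rw [Finset.smul_sum]
  exact Finset.sum_congr rfl fun j _ => smul_comm ((t ^ j : ℝ) : ℂ) (h : ℂ) (z j)

/-- The residual of the truncated sum `U_n(h)` is a polynomial in `h^{1/2}` divisible by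
`h^{(n + 3) / 2}`. -/
theorem exists_residual {χ : 𝓢(ℝ, ℝ)} {β : R3} {x : Fin N → R3} {u a b : ℕ → StateSpace N}
    {e : ℕ → ℝ} (he : ∀ n, Odd n → e n = 0)
    (ha : ∀ n, IsFreeImage β (u n) (a n)) (hb : ∀ n, IsInteractionImage χ x (u n) (b n))
    (h0 : a 0 = (e 0 : ℂ) • u 0)
    (hrec : ∀ n, a (n + 1) + b n
      = ∑ p ∈ Finset.HasAntidiagonal.antidiagonal (n + 1), (e p.1 : ℂ) • u p.2)
    {n p : ℕ} (hn : n ≤ 2 * p + 1) :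
    ∃ (K : ℕ) (f : ℕ → StateSpace N), ∀ (h : ℝ), 0 < h →
      ∀ hd : truncation u n h ∈ (hamiltonian χ β x h).domain,
        hamiltonian χ β x h ⟨truncation u n h, hd⟩
          - (approxEigenvalue (fun j => e (2 * (j - 1))) p h : ℂ) • truncation u n h
        = ∑ k ∈ Finset.range (K + 1), ((√h ^ (n + 3 + k) : ℝ) : ℂ) • f k := by
  -- Since `n ≤ 2 * p + 1`, the only eigenvalue coefficient that could be missed is the one of odd
  -- index `2 * p + 1`.
  obtain ⟨K, f, hf⟩ := isPolyTail_residual h0 hrec n (2 * p) fun i h1 h2 =>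
    he i ⟨p, by omega⟩
  refine ⟨K, f, fun h hh hd => ?_⟩
  have hG := LinearPMap.mem_graph_iff _ |>.1 (truncation_mem_graph ha hb n h)
  obtain ⟨⟨z, hz⟩, h1, h2⟩ := hG
  simp only at h1 h2
  subst h1
  rw [h2, approxEigenvalue_eq he p hh.le, truncation]
  simp only [rpow_eq_sqrt_pow (n := _) hh (mul_div_cancel₀ _ (two_ne_zero' ℝ))]
  exact smul_isPolyTail (Real.sq_sqrt hh.le) _ (hf √h)

theorem norm_sum_sqrt_pow_le {E : Type*} [NormedAddCommGroup E] [InnerProductSpace ℂ E]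
    (f : ℕ → E) (K d : ℕ) {h : ℝ} (h1 : h ≤ 1) :
    ‖∑ k ∈ Finset.range (K + 1), ((√h ^ (d + k) : ℝ) : ℂ) • f k‖
      ≤ (∑ k ∈ Finset.range (K + 1), ‖f k‖) * √h ^ d := by
  have ht0 : 0 ≤ √h := Real.sqrt_nonneg h
  have ht1 : √h ≤ 1 := Real.sqrt_le_one.2 h1
  rw [Finset.sum_mul]
  refine (norm_sum_le _ _).trans (Finset.sum_le_sum fun k _ => ?_)
  rw [norm_smul, Complex.norm_real, Real.norm_of_nonneg (by positivity), mul_comm]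
  exact mul_le_mul_of_nonneg_left (pow_le_pow_of_le_one ht0 ht1 (Nat.le_add_right d k))
    (norm_nonneg _)

theorem sum_range_succ_eq_sum_Icc {M : Type*} [AddCommMonoid M] (g : ℕ → M) (K : ℕ) :
    ∑ k ∈ Finset.range (K + 1), g (k + 1) = ∑ k ∈ Finset.Icc 1 (K + 1), g k := by
  induction K with
  | zero => simp
  | succ K ih =>
    rw [Finset.sum_range_succ, ih]
    exact (Finset.sum_Icc_succ_top (Nat.le_add_left 1 (K + 1)) g).symm

theorem expansions_of_residual {E : Type*} [NormedAddCommGroup E] [InnerProductSpace ℂ E]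
    {D : ℕ → ℕ → ℝ → E}
    (hres : ∀ n p, n ≤ 2 * p + 1 → ∃ (K : ℕ) (f : ℕ → E), ∀ h : ℝ, 0 < h →
      D n p h = ∑ k ∈ Finset.range (K + 1), ((√h ^ (n + 3 + k) : ℝ) : ℂ) • f k) :
    (∀ p : ℕ, ∃ C : ℝ, ∀ h : ℝ, 0 < h → h ≤ 1 →
      ‖D (2 * p) p h‖ ≤ C * h ^ ((p : ℝ) + 3 / 2)) ∧
    (∀ p : ℕ, ∃ C : ℝ, ∀ h : ℝ, 0 < h → h ≤ 1 →
      ‖D (2 * p + 1) p h‖ ≤ C * h ^ ((p : ℝ) + 2)) ∧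
    (∀ p : ℕ, ∃ (K : ℕ) (f : ℕ → E), ∀ h : ℝ, 0 < h → D (2 * p) p h
      = ∑ k ∈ Finset.Icc 1 K, ((h ^ ((p : ℝ) + 1 + (k : ℝ) / 2) : ℝ) : ℂ) • f k) ∧
    (∀ p : ℕ, ∃ (K : ℕ) (f : ℕ → E), ∀ h : ℝ, 0 < h → D (2 * p + 1) p h
      = ∑ k ∈ Finset.range (K + 1), ((h ^ ((p : ℝ) + 2 + (k : ℝ) / 2) : ℝ) : ℂ) • f k) := by
  refine ⟨fun p => ?_, fun p => ?_, fun p => ?_, fun p => ?_⟩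
  · obtain ⟨K, f, hf⟩ := hres (2 * p) p (by omega)
    exact ⟨_, fun h hh h1 => ((congrArg norm (hf h hh)).le.trans
      (norm_sum_sqrt_pow_le f K _ h1)).trans_eq (congrArg (_ * ·)
        (rpow_eq_sqrt_pow hh (n := 2 * p + 3) (by push_cast; ring)).symm)⟩
  · obtain ⟨K, f, hf⟩ := hres (2 * p + 1) p (by omega)
    exact ⟨_, fun h hh h1 => ((congrArg norm (hf h hh)).le.trans
      (norm_sum_sqrt_pow_le f K _ h1)).trans_eq (congrArg (_ * ·)
        (rpow_eq_sqrt_pow hh (n := 2 * p + 1 + 3) (by push_cast; ring)).symm)⟩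
  · obtain ⟨K, f, hf⟩ := hres (2 * p) p (by omega)
    -- For `n = 2 p` the lowest power is `h ^ (p + 3/2)`, which is the term `k = 1` of the required
    -- expansion; hence the shift of the coefficients by one.
    refine ⟨K + 1, fun k => f (k - 1), fun h hh => (hf h hh).trans
      ((Finset.sum_congr rfl fun k _ => ?_).trans (sum_range_succ_eq_sum_Icc
        (fun k => ((h ^ ((p : ℝ) + 1 + (k : ℝ) / 2) : ℝ) : ℂ) • f (k - 1)) K))⟩
    exact congrArg (fun r : ℝ => (r : ℂ) • f k)
      (rpow_eq_sqrt_pow hh (n := 2 * p + 3 + k) (by push_cast; ring)).symm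
  · obtain ⟨K, f, hf⟩ := hres (2 * p + 1) p (by omega)
    refine ⟨K, f, fun h hh => (hf h hh).trans (Finset.sum_congr rfl fun k _ => ?_)⟩
    exact congrArg (fun r : ℝ => (r : ℂ) • f k)
      (rpow_eq_sqrt_pow hh (n := 2 * p + 1 + 3 + k) (by push_cast; ring)).symm

/-! ### The unperturbed eigenvector -/

theorem stateParitySpace_add_two (ρ : ℝ) (j : ℕ) :
    stateParitySpace N ρ (j + 2) = stateParitySpace N ρ j := by
  ext ψ
  show (∀ s, (∃ n : ℕ, ∀ m, n < m → ψ s m = 0) ∧ (∀ m, m % 2 ≠ (j + 2) % 2 → ψ s m = 0) ∧ _) ↔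
    ∀ s, (∃ n : ℕ, ∀ m, n < m → ψ s m = 0) ∧ (∀ m, m % 2 ≠ j % 2 → ψ s m = 0) ∧ _
  rw [Nat.add_mod_right]

theorem norm_pureTensor_spinTensor {Ψ : PhotonFock} (hΨ : ‖Ψ‖ = 1)
    {b : EuclideanSpace ℂ (Fin 2)} (hb : ‖b‖ = 1) :
    ‖(pureTensor Ψ (spinTensor fun _ => b) : StateSpace N)‖ = 1 := by
  have hb2 := EuclideanSpace.norm_sq_eq b
  have h : ‖(pureTensor Ψ (spinTensor fun _ => b) : StateSpace N)‖ ^ 2 = 1 := by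
    rw [PiLp.norm_sq_eq_of_L2]
    simp only [pureTensor, spinTensor, norm_smul, hΨ, mul_one, norm_prod, ← Finset.prod_pow]
    rw [← Fintype.piFinset_univ, ← Finset.prod_univ_sum (fun _ : Fin N => Finset.univ)
      (fun _ a => ‖b a‖ ^ 2), ← hb2, hb]
    simp
  exact (pow_eq_one_iff_of_nonneg (norm_nonneg _) two_ne_zero).1 h

/-- In every sector one of the two vectors vanishes. This is the source of the vanishing of the odd
eigenvalue coefficients. -/
theorem inner_vacuum_eq_zero {Ψ : PhotonFock} (hΨ : ∀ m : ℕ, m ≠ 0 → Ψ m = 0) {ρ : ℝ}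
    {c : Config N → ℂ} {u₀ w : StateSpace N} (hu₀ : ∀ s, u₀ s = c s • Ψ)
    (hw : w ∈ stateParitySpace N ρ 1) : inner ℂ u₀ w = 0 := by
  rw [PiLp.inner_apply]
  refine Finset.sum_eq_zero fun s _ => ?_
  rw [hu₀, inner_smul_left, inner_eq_sum_of_finite (M := 0) (fun _ => rfl) (fun _ => rfl),
    Finset.sum_range_zero, mul_zero]
  intro m _
  by_cases hm : m = 0
  · exact Or.inr ((hw s).2.1 m (by rw [hm]; decide))
  · exact Or.inl (hΨ m hm)

theorem exists_formal_quasimode (x : Fin N → R3) {β : R3} (hβ : β ≠ 0)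
    {χ : 𝓢(ℝ, ℝ)} {ρ : ℝ} (hρ : 0 < ρ) (hχ : ∀ t : ℝ, 0 ≤ t → t ≤ ρ → χ t = 0)
    {b₀ : EuclideanSpace ℂ (Fin 2)} (hb₀ : ‖b₀‖ = 1)
    (hb₀' : (∑ m : Fin 3, (β m : ℂ) • pauli m) *ᵥ b₀.ofLp = (-(‖β‖ : ℂ)) • b₀.ofLp)
    {Ψ₀ : PhotonFock} (hΨ₀ : ∀ m : ℕ, m ≠ 0 → Ψ₀ m = 0) (hΨ₀' : ‖Ψ₀‖ = 1) :
    ∃ (u a c : ℕ → StateSpace N) (e : ℕ → ℝ), u 0 = pureTensor Ψ₀ (spinTensor fun _ => b₀) ∧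
      e 0 = -((N : ℝ) * ‖β‖) ∧ (∀ n, u n ∈ stateParitySpace N ρ n) ∧ (∀ n, Odd n → e n = 0) ∧
      (∀ n, IsFreeImage β (u n) (a n)) ∧ (∀ n, IsInteractionImage χ x (u n) (c n)) ∧
      a 0 = (e 0 : ℂ) • u 0 ∧
      ∀ n, a (n + 1) + c n
        = ∑ p ∈ Finset.HasAntidiagonal.antidiagonal (n + 1), (e p.1 : ℂ) • u p.2 := by
  obtain ⟨b, hb0, hb, hb'⟩ := exists_pauli_eigenbasis hb₀ hb₀'
  set u₀ : StateSpace N := pureTensor Ψ₀ (spinTensor fun _ => b₀) with hu₀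
  have hu₀s : ∀ s, u₀ s = (∏ i, b 0 (s i)) • Ψ₀ := fun s => by rw [hb0]; rfl
  obtain ⟨u, a, c, e, hu0, he0, hP, hodd, hA, hV, ha0, hrec⟩ :=
    exists_formal_eigenvector (IsFreeImage β) (IsInteractionImage χ x) (stateParitySpace N ρ)
      (fun j => stateParitySpace_add_two ρ j) (u₀ := u₀) (e₀ := -((N : ℝ) * ‖β‖))
      (fun s => by
        rw [hu₀s]
        exact Submodule.smul_mem _ _ (mem_paritySpace_of_vacuum hΨ₀ ρ))
      (norm_pureTensor_spinTensor hΨ₀' hb₀)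
      (fun w hw => inner_vacuum_eq_zero hΨ₀ hu₀s hw)
      (by
        have h := isFreeImage_vacuum hΨ₀ (hb 0) hu₀s
        simpa using h)
      (fun j w hw => exists_isInteractionImage hχ x hw)
      (fun j w hw => exists_resolvent_free hβ hρ hΨ₀ hΨ₀' hb hb' hu₀s hw)
      (fun _ _ _ _ h h' => h.inner_symm h')
      (fun _ _ _ hψ _ hψ' _ _ h h' => h.inner_symm hψ hψ' h')
  exact ⟨u, a, c, e, hu0, he0, hP, hodd, hA, hV, by rw [ha0, he0, hu0], hrec⟩

set_option maxHeartbeats 1000000 in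
/-- Quasimodes of arbitrary order of the Hamiltonian of `N` fixed spin-1/2 particles at the points
`x l`, in the constant magnetic field `β`, interacting with the quantized field. Here `Ψ₀` is a unit
vector of `F_0`, and `b₀` is a unit eigenvector of `∑ β_m σ_m` for the eigenvalue `-|β|`. -/
theorem theorem6p5 (N : ℕ) (x : Fin N → R3) (β : R3) (hβ : β ≠ 0)
    (χ : 𝓢(ℝ, ℝ)) (ρ : ℝ) (hρ : 0 < ρ) (hχ : ∀ t : ℝ, 0 ≤ t → t ≤ ρ → χ t = 0)
    (b₀ : EuclideanSpace ℂ (Fin 2)) (hb₀ : ‖b₀‖ = 1)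
    (hb₀' : (∑ m : Fin 3, (β m : ℂ) • pauli m) *ᵥ b₀.ofLp = (-(‖β‖ : ℂ)) • b₀.ofLp)
    (Ψ₀ : PhotonFock) (hΨ₀ : ∀ m : ℕ, m ≠ 0 → Ψ₀ m = 0) (hΨ₀' : ‖Ψ₀‖ = 1) :
    ∃ (u : ℕ → StateSpace N) (lam : ℕ → ℝ),
      u 0 = pureTensor Ψ₀ (spinTensor fun _ => b₀) ∧
      lam 1 = -((N : ℝ) * ‖β‖) ∧
      (∀ j : ℕ, HasParity ρ j (u j)) ∧
      ∃ hdom : ∀ (n : ℕ) (h : ℝ), truncation u n h ∈ (hamiltonian χ β x h).domain,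
        (∀ p : ℕ, ∃ C : ℝ, ∀ h : ℝ, 0 < h → h ≤ 1 →
          ‖hamiltonian χ β x h ⟨truncation u (2 * p) h, hdom (2 * p) h⟩
              - (approxEigenvalue lam p h : ℂ) • truncation u (2 * p) h‖
            ≤ C * h ^ ((p : ℝ) + 3 / 2)) ∧
        (∀ p : ℕ, ∃ C : ℝ, ∀ h : ℝ, 0 < h → h ≤ 1 →
          ‖hamiltonian χ β x h ⟨truncation u (2 * p + 1) h, hdom (2 * p + 1) h⟩
              - (approxEigenvalue lam p h : ℂ) • truncation u (2 * p + 1) h‖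
            ≤ C * h ^ ((p : ℝ) + 2)) ∧
        (∀ p : ℕ, ∃ (K : ℕ) (f : ℕ → StateSpace N), ∀ h : ℝ, 0 < h →
          hamiltonian χ β x h ⟨truncation u (2 * p) h, hdom (2 * p) h⟩
              - (approxEigenvalue lam p h : ℂ) • truncation u (2 * p) h
            = ∑ k ∈ Finset.Icc 1 K, ((h ^ ((p : ℝ) + 1 + (k : ℝ) / 2) : ℝ) : ℂ) • f k) ∧
        (∀ p : ℕ, ∃ (K : ℕ) (f : ℕ → StateSpace N), ∀ h : ℝ, 0 < h →
          hamiltonian χ β x h ⟨truncation u (2 * p + 1) h, hdom (2 * p + 1) h⟩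
              - (approxEigenvalue lam p h : ℂ) • truncation u (2 * p + 1) h
            = ∑ k ∈ Finset.range (K + 1),
                ((h ^ ((p : ℝ) + 2 + (k : ℝ) / 2) : ℝ) : ℂ) • f k) := by
  obtain ⟨u, a, c, e, hu0, he0, hP, hodd, hA, hV, ha0', hrec⟩ :=
    exists_formal_quasimode x hβ hρ hχ hb₀ hb₀' hΨ₀ hΨ₀'
  have hdom : ∀ (n : ℕ) (h : ℝ), truncation u n h ∈ (hamiltonian χ β x h).domain := fun n h =>
    LinearPMap.mem_domain_of_mem_graph (truncation_mem_graph hA hV n h)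
  -- `lam j` multiplies `h ^ j = h * √h ^ (2 * (j - 1))`. The value at `j = 0`, produced by
  -- truncated subtraction, is never used.
  refine ⟨u, fun j => e (2 * (j - 1)), hu0, he0, hP, hdom, expansions_of_residual
    (D := fun n p h => hamiltonian χ β x h ⟨truncation u n h, hdom n h⟩
      - (approxEigenvalue (fun j => e (2 * (j - 1))) p h : ℂ) • truncation u n h)
    fun n p hn => ?_⟩
  obtain ⟨K, f, hf⟩ := exists_residual hodd hA hV ha0' hrec hn
  exact ⟨K, f, fun h hh => hf h hh _⟩

end
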